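/- Let $d\ge 3$, let $G<O(d)$ be an irreducible finite reflection group, that is, a finite subgroup of $O(d)$ which is generated by reflections across linear hyperplanes and whose inclusion representation on $\mathbb{R}^d$ is irreducible. Let $G^+=G\cap SO(d)$ be its rotation subgroup, let $r=|G^+|$ and let $N=(r-2)(d+1)+2$. Then there is a dense open subset of $(\mathbb{R}^d)^N$ with full Lebesgue measure such that for every $(z_1,\dots,z_N)$ in it the points $z_1,\dots,z_N$ are distinct and the set $\{z_1,\dots,z_N\}$ can be $P$-partitioned by a Coxeter alternahedron $P$ with isometry group $G^+$. Explicitly, there are $a\in\mathbb{R}^d$ and $u\in\mathbb{R}^d\setminus\{0\}$ with trivial stabilizer in $G^+$ such that the polytope $P=\operatorname{Conv}(a+G^+\cdot u)$ has the following properties: (i) $P$ is $d$-dimensional and has exactly $r$ vertices; (ii) the isometries of $\mathbb{R}^d$ which map $P$ onto itself are precisely the maps $x\mapsto a+g(x-a)$ with $g\in G^+$; (iii) there are a partition $A_1,\dots,A_r$ of $\{z_1,\dots,z_N\}$ and points $x_1\in\operatorname{Conv}(A_1),\dots,x_r\in\operatorname{Conv}(A_r)$, pairwise distinct, such that $\{x_1,\dots,x_r\}$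 is the vertex set of $P$. -/

import Mathlib

open MeasureTheory

noncomputable section

namespace Alternahedra

/-- Euclidean space `ℝᵈ`. -/
abbrev Euc (d : ℕ) : Type := EuclideanSpace ℝ (Fin d)

/-- The orthogonal group `O(d)`, as the group of linear isometries of `ℝᵈ`. -/
abbrev Orth (d : ℕ) : Type := Euc d ≃ₗᵢ[ℝ] Euc d

/-! ### Finite reflection groups -/

/-- `s` is the orthogonal reflection across a linear hyperplane `vᗮ`, `v ≠ 0`. -/
def IsHyperplaneReflection {d : ℕ} (s : Orth d) : Prop :=
  ∃ v : Euc d, v ≠ 0 ∧ s = (Submodule.span ℝ {v})ᗮ.reflection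

/-- A finite reflection group: a finite subgroup of `O(d)` generated by reflections across linear
hyperplanes. -/
def IsFiniteReflectionGroup {d : ℕ} (G : Subgroup (Orth d)) : Prop :=
  Finite G ∧ ∃ S : Set (Orth d), (∀ s ∈ S, IsHyperplaneReflection s) ∧ Subgroup.closure S = G

/-- The inclusion representation of a subgroup `G` of `O(d)` on `ℝᵈ`. -/
def inclusionRep {d : ℕ} (G : Subgroup (Orth d)) : Representation ℝ G (Euc d) where
  toFun g := ((g : Orth d).toLinearEquiv : Euc d →ₗ[ℝ] Euc d)
  map_one' := rfl
  map_mul' _ _ := rfl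

/-- The rotation subgroup `G⁺ = G ∩ SO(d)` of a subgroup `G` of `O(d)`. -/
def rotationSubgroup {d : ℕ} (G : Subgroup (Orth d)) : Subgroup (Orth d) where
  carrier := {g | g ∈ G ∧ LinearMap.det (g.toLinearEquiv : Euc d →ₗ[ℝ] Euc d) = 1}
  one_mem' := ⟨G.one_mem, LinearMap.det_id⟩
  mul_mem' := by
    rintro g h ⟨hg, hg1⟩ ⟨hh, hh1⟩
    refine ⟨G.mul_mem hg hh, ?_⟩
    have : ((g * h).toLinearEquiv : Euc d →ₗ[ℝ] Euc d)
        = (g.toLinearEquiv : Euc d →ₗ[ℝ] Euc d) ∘ₗ (h.toLinearEquiv : Euc d →ₗ[ℝ] Euc d) := rfl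
    rw [this, LinearMap.det_comp, hg1, hh1, one_mul]
  inv_mem' := by
    rintro g ⟨hg, hg1⟩
    refine ⟨G.inv_mem hg, ?_⟩
    have h : (g.toLinearEquiv : Euc d →ₗ[ℝ] Euc d)
        ∘ₗ ((g⁻¹).toLinearEquiv : Euc d →ₗ[ℝ] Euc d) = LinearMap.id := by
      ext1 x
      exact g.apply_symm_apply x
    have h2 := congrArg LinearMap.det h
    rwa [LinearMap.det_comp, hg1, one_mul, LinearMap.det_id] at h2

/-! ### Polytopes, orbit polytopes, isometry groups -/

/-- `P` is a `d`-dimensional polytope in `ℝᵈ` with exactly `r` vertices. -/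
def IsFullPolytope {d : ℕ} (r : ℕ) (P : Set (Euc d)) : Prop :=
  (∃ S : Set (Euc d), S.Finite ∧ P = convexHull ℝ S) ∧ affineSpan ℝ P = ⊤ ∧
    (P.extremePoints ℝ).ncard = r

/-- The orbit polytope `P(H; u, a) = conv (a + H · u)`. -/
def orbitPolytope {d : ℕ} (H : Subgroup (Orth d)) (u a : Euc d) : Set (Euc d) :=
  convexHull ℝ {x | ∃ g ∈ H, x = a + g u}

/-- `u ≠ 0` has trivial stabilizer in `H`, i.e. every `P(H; u, a)` is a free orbit polytope. -/
def IsFreeVector {d : ℕ} (H : Subgroup (Orth d)) (u : Euc d) : Prop :=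
  u ≠ 0 ∧ ∀ g ∈ H, g u = u → g = 1

/-- `P` is a Coxeter alternahedron of the reflection group `G` with centre `a`: a free orbit
polytope `conv (a + G⁺ · u)` of the rotation subgroup of `G`. -/
def IsCoxeterAlternahedron {d : ℕ} (G : Subgroup (Orth d)) (a : Euc d) (P : Set (Euc d)) : Prop :=
  ∃ u : Euc d, IsFreeVector (rotationSubgroup G) u ∧ P = orbitPolytope (rotationSubgroup G) u a

/-- The isometry group of `P`: all isometries of `ℝᵈ` mapping `P` onto itself. -/
def isoGroup {d : ℕ} (P : Set (Euc d)) : Subgroup (Euc d ≃ᵢ Euc d) where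
  carrier := {φ | φ '' P = P}
  one_mem' := Set.image_id P
  mul_mem' := by
    intro φ ψ (hφ : φ '' P = P) (hψ : ψ '' P = P)
    change (fun x => φ (ψ x)) '' P = P
    rw [← Set.image_image, hψ, hφ]
  inv_mem' := by
    intro φ (hφ : φ '' P = P)
    change φ.symm '' P = P
    conv_lhs => rw [← hφ]
    rw [Set.image_image]
    simp

/-- The group `H ≤ O(d)` acting by isometries on `ℝᵈ` around the centre `a`, that is, by
`x ↦ a + g (x - a)`, `g ∈ H`. -/
def actionAround {d : ℕ} (H : Subgroup (Orth d)) (a : Euc d) : Subgroup (Euc d ≃ᵢ Euc d) where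
  carrier := {φ | ∃ g ∈ H, ∀ x, φ x = a + g (x - a)}
  one_mem' := ⟨1, H.one_mem, fun x => by simp⟩
  mul_mem' := by
    rintro φ ψ ⟨g, hg, hφ⟩ ⟨h, hh, hψ⟩
    refine ⟨g * h, H.mul_mem hg hh, fun x => ?_⟩
    change φ (ψ x) = a + g (h (x - a))
    rw [hφ, hψ]
    simp
  inv_mem' := by
    rintro φ ⟨g, hg, hφ⟩
    refine ⟨g⁻¹, H.inv_mem hg, fun x => ?_⟩
    apply φ.injective
    change φ (φ.symm x) = φ (a + g.symm (x - a))
    rw [φ.apply_symm_apply, hφ]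
    simp

/-! ### Polytopal partitions and genericity -/

/-- The point set `X ⊆ ℝᵈ` can be `P`-partitioned, for `P` a `d`-polytope on `r` vertices: there
are a partition `A₁, …, A_r` of `X` and `r` points `xᵢ ∈ conv Aᵢ` such that `{x₁, …, x_r}` is the
vertex set (= set of extreme points) of `P`. -/
def CanBePartitioned {d : ℕ} (r : ℕ) (X P : Set (Euc d)) : Prop :=
  IsFullPolytope r P ∧
  ∃ (A : Fin r → Set (Euc d)) (x : Fin r → Euc d),
    Pairwise (fun i j => Disjoint (A i) (A j)) ∧ (⋃ i, A i) = X ∧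
    (∀ i, x i ∈ convexHull ℝ (A i)) ∧ Function.Injective x ∧ Set.range x = P.extremePoints ℝ

/-- The property `Q` holds for a generic set of `N` points in `ℝᵈ`: on a dense open set of full
Lebesgue measure in `(ℝᵈ)ᴺ`, the `N` points are distinct and the set they form satisfies `Q`. -/
def HoldsForGenericSet (N d : ℕ) (Q : Set (Euc d) → Prop) : Prop :=
  ∃ U : Set (Fin N → Euc d), IsOpen U ∧ Dense U ∧ volume Uᶜ = 0 ∧
    ∀ z ∈ U, Function.Injective z ∧ Q (Set.range z)

end Alternahedra

end

/-! Write `H` for the rotation group. Existence holds for every configuration, by Sarkaria's trick.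
Place `r` copies of each lifted point `(z j, 1)` in the slots of `H → Euc d × ℝ` and divide by the
(2d+1)-dimensional space of families `(a + g u, s)`. The quotient has dimension r(d+1) - (2d+1) = N
- 1, and the copies of each point sum to zero there. Colorful Carathéodory
(`exists_colorful_sum_eq_zero`) therefore colours the points by `H` so that suitable convex
combinations of the classes are exactly the points `a + g u`.

Genericity of `z` makes `u` generic. For a fixed colouring, weights, centre and `u` have (N - r) +
2d = rd parameters, as many as there are equations, so almost every `z` keeps `u` off the zero set
of any nonzero form `⟪g v, v⟫ - ⟪k v, v⟫` with `g, k ∈ G`. Finitely many closed null sets are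
removed.

For such `u` the orbit has no extra symmetry (`IsGenericVector.eq_one_of_permutes_orbit`). Up to a
rotation, a symmetry `h` fixes `u`; inner products within the orbit then determine products of two
reflections up to inversion. Hence the vectors on which `h` acts compatibly with the orbit form a
subspace stable under all t + t⁻¹. For d ≥ 3 such a subspace is stable under projection onto every
root line, and since it contains `u`, which lies on no mirror, it is everything. -/

namespace Alternahedra

/-! ### Products of two reflections as planar rotations -/

section Planar

variable {E : Type*} [NormedAddCommGroup E] [InnerProductSpace ℝ E]

open scoped InnerProductSpace

theorem hyperplaneReflection_apply {a : E} (ha : ‖a‖ = 1) (v : E) :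
    (Submodule.span ℝ {a})ᗮ.reflection v = v - (2 * ⟪a, v⟫_ℝ) • a := by
  rw [Submodule.reflection_orthogonal_apply, Submodule.reflection_singleton_apply, ha]
  simp only [RCLike.ofReal_real_eq_id, id, one_pow, div_one, mul_smul]
  simp [two_smul]

/-- Gram–Schmidt for two independent unit vectors. -/
theorem exists_orthonormal_decomposition {a b : E} (ha : ‖a‖ = 1) (hb : b ∉ Submodule.span ℝ {a}) :
    ∃ (e : E) (x y : ℝ), ‖e‖ = 1 ∧ ⟪a, e⟫_ℝ = 0 ∧ b = x • a + y • e ∧ y ≠ 0 := by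
  set w := b - ⟪a, b⟫_ℝ • a with hw
  have hw0 : w ≠ 0 := by
    intro h
    apply hb
    rw [sub_eq_zero.1 h]
    exact Submodule.smul_mem _ _ (Submodule.mem_span_singleton_self a)
  have hn : ‖w‖ ≠ 0 := norm_ne_zero_iff.2 hw0
  refine ⟨‖w‖⁻¹ • w, ⟪a, b⟫_ℝ, ‖w‖, ?_, ?_, ?_, hn⟩
  · rw [norm_smul, norm_inv, norm_norm, inv_mul_cancel₀ hn]
  · rw [inner_smul_right, hw, inner_sub_right, inner_smul_right, real_inner_self_eq_norm_sq, ha]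
    simp
  · rw [smul_smul, mul_inv_cancel₀ hn, one_smul, hw]
    abel

theorem sq_add_sq_eq_one_of_norm {a e : E} {x y : ℝ} (ha : ‖a‖ = 1) (he : ‖e‖ = 1)
    (hae : ⟪a, e⟫_ℝ = 0) (hb : ‖x • a + y • e‖ = 1) : x ^ 2 + y ^ 2 = 1 := by
  have haa : ⟪a, a⟫_ℝ = 1 := by rw [real_inner_self_eq_norm_sq, ha, one_pow]
  have hee : ⟪e, e⟫_ℝ = 1 := by rw [real_inner_self_eq_norm_sq, he, one_pow]
  have hea : ⟪e, a⟫_ℝ = 0 := by rw [real_inner_comm, hae]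
  have := real_inner_self_eq_norm_sq (x • a + y • e)
  rw [hb] at this
  simp only [inner_add_left, inner_add_right, inner_smul_left, inner_smul_right, haa, hee, hae,
      hea] at this
  simp at this
  linarith

/-- With x = cos θ and y = sin θ this is a rotation by angle 2θ (up to orientation) in the plane of
`a` and `e`: the coefficients are cos 2θ - 1 and -sin 2θ. The opposite order gives the inverse, so
only the skew term changes sign. -/
theorem reflection_comp_apply {a e : E} {x y : ℝ} (ha : ‖a‖ = 1) (he : ‖e‖ = 1)
    (hae : ⟪a, e⟫_ℝ = 0) (hb : ‖x • a + y • e‖ = 1) (v : E) :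
    (Submodule.span ℝ {a})ᗮ.reflection ((Submodule.span ℝ {x • a + y • e})ᗮ.reflection v)
      = v + (-2 * y ^ 2) • (⟪a, v⟫_ℝ • a + ⟪e, v⟫_ℝ • e)
        + (-2 * x * y) • (⟪a, v⟫_ℝ • e - ⟪e, v⟫_ℝ • a) := by
  have haa : ⟪a, a⟫_ℝ = 1 := by rw [real_inner_self_eq_norm_sq, ha, one_pow]
  have hea : ⟪e, a⟫_ℝ = 0 := by rw [real_inner_comm, hae]
  have hxy := sq_add_sq_eq_one_of_norm ha he hae hb
  rw [hyperplaneReflection_apply ha, hyperplaneReflection_apply hb]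
  simp only [inner_add_left, inner_sub_right, inner_add_right, inner_smul_left, inner_smul_right,
    haa, hae, RCLike.conj_to_real]
  match_scalars
  · ring
  · linear_combination (2 * ⟪a, v⟫_ℝ) * hxy
  · ring

theorem reflection_comp_apply' {a e : E} {x y : ℝ} (ha : ‖a‖ = 1) (he : ‖e‖ = 1)
    (hae : ⟪a, e⟫_ℝ = 0) (hb : ‖x • a + y • e‖ = 1) (v : E) :
    (Submodule.span ℝ {x • a + y • e})ᗮ.reflection ((Submodule.span ℝ {a})ᗮ.reflection v)
      = v + (-2 * y ^ 2) • (⟪a, v⟫_ℝ • a + ⟪e, v⟫_ℝ • e)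
        - (-2 * x * y) • (⟪a, v⟫_ℝ • e - ⟪e, v⟫_ℝ • a) := by
  have haa : ⟪a, a⟫_ℝ = 1 := by rw [real_inner_self_eq_norm_sq, ha, one_pow]
  have hea : ⟪e, a⟫_ℝ = 0 := by rw [real_inner_comm, hae]
  have hxy := sq_add_sq_eq_one_of_norm ha he hae hb
  rw [hyperplaneReflection_apply ha, hyperplaneReflection_apply hb]
  simp only [inner_add_left, inner_sub_right, inner_smul_left, inner_smul_right,
    haa, hea, RCLike.conj_to_real]
  match_scalars
  · ring
  · linear_combination (2 * ⟪a, v⟫_ℝ) * hxy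
  · ring

/-- A subspace stable under `t + t⁻¹` for the planar rotations `t = s_a s_b` and `t = s_a s_c` with
`a, b, c` independent is stable under the orthogonal projection onto the line of `a`. -/
theorem inner_smul_mem_of_stable (X : Submodule ℝ E) {a b c : E} (ha : ‖a‖ = 1) (hb : ‖b‖ = 1)
    (hc : ‖c‖ = 1) (hab : b ∉ Submodule.span ℝ {a}) (habc : c ∉ Submodule.span ℝ {a, b})
    (hXb : ∀ v ∈ X, (Submodule.span ℝ {a})ᗮ.reflection ((Submodule.span ℝ {b})ᗮ.reflection v)
      + (Submodule.span ℝ {b})ᗮ.reflection ((Submodule.span ℝ {a})ᗮ.reflection v) ∈ X)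
    (hXc : ∀ v ∈ X, (Submodule.span ℝ {a})ᗮ.reflection ((Submodule.span ℝ {c})ᗮ.reflection v)
      + (Submodule.span ℝ {c})ᗮ.reflection ((Submodule.span ℝ {a})ᗮ.reflection v) ∈ X)
    {v : E} (hv : v ∈ X) : ⟪a, v⟫_ℝ • a ∈ X := by
  have hac : c ∉ Submodule.span ℝ {a} := fun h =>
    habc (Submodule.span_mono (by simp) h)
  obtain ⟨e, x, y, he, hae, rfl, hy⟩ := exists_orthonormal_decomposition ha hab
  obtain ⟨f, x', y', hf, haf, rfl, hy'⟩ := exists_orthonormal_decomposition ha hac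
  have key : ∀ {e : E} {x y : ℝ}, ‖e‖ = 1 → ⟪a, e⟫_ℝ = 0 → ‖x • a + y • e‖ = 1 → y ≠ 0 →
      (∀ v ∈ X, (Submodule.span ℝ {a})ᗮ.reflection
        ((Submodule.span ℝ {x • a + y • e})ᗮ.reflection v)
      + (Submodule.span ℝ {x • a + y • e})ᗮ.reflection
        ((Submodule.span ℝ {a})ᗮ.reflection v) ∈ X) →
      ∀ v ∈ X, ⟪a, v⟫_ℝ • a + ⟪e, v⟫_ℝ • e ∈ X := by
    intro e x y he hae hb hy h v hv
    have h1 := h v hv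
    rw [reflection_comp_apply ha he hae hb, reflection_comp_apply' ha he hae hb] at h1
    -- The skew terms cancel in t + t⁻¹, leaving 2 - 4y²P with P the orthogonal projection onto the
    -- plane of `a` and `e`.
    have h2 : (4 * y ^ 2) • (⟪a, v⟫_ℝ • a + ⟪e, v⟫_ℝ • e) ∈ X := by
      have := X.sub_mem (X.smul_mem 2 hv) h1
      convert this using 1
      module
    exact (X.smul_mem_iff (by positivity)).1 h2
  have hp := key he hae hb hy hXb
  have hq := key hf haf hc hy' hXc
  have haa : ⟪a, a⟫_ℝ = 1 := by rw [real_inner_self_eq_norm_sq, ha, one_pow]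
  have hee : ⟪e, e⟫_ℝ = 1 := by rw [real_inner_self_eq_norm_sq, he, one_pow]
  have hea : ⟪e, a⟫_ℝ = 0 := by rw [real_inner_comm, hae]
  have hfa : ⟪f, a⟫_ℝ = 0 := by rw [real_inner_comm, haf]
  -- Otherwise the unit vectors `e` and `f` are parallel and the two planes through `a` coincide.
  have hne : 1 - ⟪f, e⟫_ℝ ^ 2 ≠ 0 := by
    intro h
    apply habc
    have h1 : f = ⟪f, e⟫_ℝ • e := by
      rw [← sub_eq_zero, ← norm_eq_zero, ← sq_eq_zero_iff, ← real_inner_self_eq_norm_sq]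
      simp only [inner_sub_left, inner_sub_right, inner_smul_left, inner_smul_right, hee,
        real_inner_self_eq_norm_sq, hf, RCLike.conj_to_real, real_inner_comm f e]
      linear_combination h
    have ha' : a ∈ Submodule.span ℝ {a, x • a + y • e} := Submodule.subset_span (by simp)
    have he' : e ∈ Submodule.span ℝ {a, x • a + y • e} := by
      have h2 : x • a + y • e ∈ Submodule.span ℝ {a, x • a + y • e} :=
        Submodule.subset_span (by simp)
      have h3 := Submodule.sub_mem _ h2 (Submodule.smul_mem _ x ha')
      rw [add_sub_cancel_left] at h3
      exact (Submodule.smul_mem_iff _ hy).1 h3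
    refine Submodule.add_mem _ (Submodule.smul_mem _ _ ha') (Submodule.smul_mem _ _ ?_)
    rw [h1]
    exact Submodule.smul_mem _ _ he'
  -- With P, Q the projections onto the planes of `a, e` and `a, f`, the map PQP fixes `a` and
  -- scales `e` by `⟪f, e⟫ ^ 2`. So PQP - `⟪f, e⟫ ^ 2` P is a nonzero multiple of the projection
  -- onto the line of `a`.
  have h1 := hp v hv
  have h2 := hp _ (hq _ h1)
  have h3 := X.sub_mem h2 (X.smul_mem (⟪f, e⟫_ℝ ^ 2) h1)
  refine (X.smul_mem_iff hne).1 ?_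
  convert h3 using 1
  simp only [inner_add_right, inner_smul_right, haa, hae, hea, haf, hfa,
    real_inner_comm e f]
  module

/-- An isometry with the same quadratic form as a planar rotation `s_a s_b` is this rotation or its
inverse. -/
theorem eq_reflection_comp_or_of_inner_eq {a b : E} (ha : ‖a‖ = 1) (hb : ‖b‖ = 1)
    (k : E ≃ₗᵢ[ℝ] E)
    (hk : ∀ v, ⟪k v, v⟫_ℝ =
      ⟪(Submodule.span ℝ {a})ᗮ.reflection ((Submodule.span ℝ {b})ᗮ.reflection v), v⟫_ℝ) :
    (∀ v, k v = (Submodule.span ℝ {a})ᗮ.reflection ((Submodule.span ℝ {b})ᗮ.reflection v)) ∨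
    (∀ v, k v = (Submodule.span ℝ {b})ᗮ.reflection ((Submodule.span ℝ {a})ᗮ.reflection v)) := by
  have kfix : ∀ w, ⟪k w, w⟫_ℝ = ⟪w, w⟫_ℝ → k w = w := by
    intro w hw
    rw [← sub_eq_zero, ← norm_eq_zero, ← sq_eq_zero_iff, ← real_inner_self_eq_norm_sq]
    simp only [inner_sub_left, inner_sub_right, real_inner_comm (k w) w, hw,
      LinearIsometryEquiv.inner_map_map]
    ring
  -- In the degenerate case the two reflections agree and their product is the identity.
  by_cases hab : b ∈ Submodule.span ℝ {a}
  · have hs : ∀ v, (Submodule.span ℝ {b})ᗮ.reflection v = (Submodule.span ℝ {a})ᗮ.reflection v := by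
      obtain ⟨c, rfl⟩ := Submodule.mem_span_singleton.1 hab
      have hc : c * c = 1 := by
        rw [norm_smul, ha, mul_one, Real.norm_eq_abs] at hb
        rw [← abs_mul_abs_self, hb, one_mul]
      intro v
      rw [hyperplaneReflection_apply ha, hyperplaneReflection_apply hb, inner_smul_left, smul_smul,
        RCLike.conj_to_real]
      congr 2
      linear_combination 2 * ⟪a, v⟫_ℝ * hc
    left
    intro v
    rw [hs, Submodule.reflection_reflection]
    apply kfix
    rw [hk, hs, Submodule.reflection_reflection]
  obtain ⟨e, x, y, he, hae, rfl, hy⟩ := exists_orthonormal_decomposition ha hab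
  simp only [reflection_comp_apply ha he hae hb, reflection_comp_apply' ha he hae hb] at hk ⊢
  have haa : ⟪a, a⟫_ℝ = 1 := by rw [real_inner_self_eq_norm_sq, ha, one_pow]
  have hee : ⟪e, e⟫_ℝ = 1 := by rw [real_inner_self_eq_norm_sq, he, one_pow]
  have hea : ⟪e, a⟫_ℝ = 0 := by rw [real_inner_comm, hae]
  have hxy := sq_add_sq_eq_one_of_norm ha he hae hb
  -- The rotation is trivial on the complement of its plane, so equality in Cauchy–Schwarz forces
  -- `k` to be trivial there too; hence `k` preserves the plane.
  have kperp : ∀ w, ⟪a, w⟫_ℝ = 0 → ⟪e, w⟫_ℝ = 0 → k w = w := by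
    intro w h1 h2
    apply kfix
    rw [hk]
    simp [h1, h2]
  have kplane : ∀ u, (∀ w, ⟪a, w⟫_ℝ = 0 → ⟪e, w⟫_ℝ = 0 → ⟪u, w⟫_ℝ = 0) →
      k u = ⟪a, k u⟫_ℝ • a + ⟪e, k u⟫_ℝ • e := by
    intro u hu
    set w := k u - (⟪a, k u⟫_ℝ • a + ⟪e, k u⟫_ℝ • e) with hw
    have h1 : ⟪a, w⟫_ℝ = 0 := by
      simp [hw, inner_sub_right, inner_add_right, inner_smul_right, hae, ha]
    have h2 : ⟪e, w⟫_ℝ = 0 := by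
      simp [hw, inner_sub_right, inner_add_right, inner_smul_right, hea, he]
    have h3 : ⟪k u, w⟫_ℝ = 0 := by
      conv_lhs => rw [← kperp w h1 h2]
      rw [LinearIsometryEquiv.inner_map_map]
      exact hu w h1 h2
    have h4 : ⟪w, w⟫_ℝ = 0 := by
      conv_lhs => rw [hw]
      rw [inner_sub_left, inner_add_left, inner_smul_left, inner_smul_left, h1, h2, h3]
      simp
    exact sub_eq_zero.1 (inner_self_eq_zero.1 h4)
  have ka := kplane a (fun w h _ => h)
  have ke := kplane e (fun w _ h => h)
  have kaa : ⟪a, k a⟫_ℝ = 1 - 2 * y ^ 2 := by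
    rw [real_inner_comm, hk]
    simp only [inner_sub_left, inner_add_left, inner_smul_left, haa, hea, RCLike.conj_to_real]
    ring
  have kee : ⟪e, k e⟫_ℝ = 1 - 2 * y ^ 2 := by
    rw [real_inner_comm, hk]
    simp only [inner_sub_left, inner_add_left, inner_smul_left, hee, hae, RCLike.conj_to_real]
    ring
  -- The form at `a + e` sees only the sum of the off-diagonal entries, which is zero for a
  -- rotation.
  have kae : ⟪a, k e⟫_ℝ = - ⟪e, k a⟫_ℝ := by
    have h := hk (a + e)
    simp only [map_add, inner_sub_left, inner_add_left, inner_add_right, inner_smul_left, haa, hee,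
      hea, hae, RCLike.conj_to_real, real_inner_comm a (k a), real_inner_comm e (k a),
      real_inner_comm a (k e), real_inner_comm e (k e)] at h
    linarith
  -- Since `k a` has unit length, the remaining entry is known up to sign; the two signs are the
  -- rotation and its inverse.
  have hsq : ⟪e, k a⟫_ℝ ^ 2 = (-2 * x * y) ^ 2 := by
    have h1 : ⟪k a, k a⟫_ℝ = 1 := by rw [LinearIsometryEquiv.inner_map_map, haa]
    have h2 : ⟪k a, k a⟫_ℝ = ⟪a, k a⟫_ℝ ^ 2 + ⟪e, k a⟫_ℝ ^ 2 := by
      conv_lhs => rw [ka]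
      simp only [inner_add_left, inner_add_right, inner_smul_left, inner_smul_right, haa, hae, hea,
        hee, RCLike.conj_to_real]
      ring
    rw [kaa] at h2
    have hx : x ^ 2 = 1 - y ^ 2 := by linarith
    have : (-2 * x * y) ^ 2 = 4 * x ^ 2 * y ^ 2 := by ring
    rw [this, hx]
    linarith
  have kall : ∀ v, k v = v + (-2 * y ^ 2) • (⟪a, v⟫_ℝ • a + ⟪e, v⟫_ℝ • e)
        + ⟪e, k a⟫_ℝ • (⟪a, v⟫_ℝ • e - ⟪e, v⟫_ℝ • a) := by
    intro v
    have hw := kperp (v - (⟪a, v⟫_ℝ • a + ⟪e, v⟫_ℝ • e))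
      (by simp [inner_sub_right, inner_add_right, inner_smul_right, hae, ha])
      (by simp [inner_sub_right, inner_add_right, inner_smul_right, hea, he])
    rw [map_sub, map_add, map_smul, map_smul, sub_eq_iff_eq_add] at hw
    rw [hw, ka, ke, kaa, kee, kae]
    simp only [inner_add_right, inner_smul_right, hee, hea]
    module
  rcases sq_eq_sq_iff_eq_or_eq_neg.1 hsq with h | h
  · left
    intro v
    rw [kall, h]
  · right
    intro v
    rw [kall, h, neg_smul, ← sub_eq_add_neg]

end Planar

end Alternahedra

/-! ### Roots and irreducibility of the rotation subgroup -/

noncomputable section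
namespace Alternahedra

open scoped InnerProductSpace

variable {d : ℕ}

/-- The reflection across the hyperplane orthogonal to `a`. -/
def hyperplaneReflection (a : Euc d) : Orth d := (Submodule.span ℝ {a})ᗮ.reflection

/-- The unit vectors orthogonal to the mirrors of the reflections in `G`. -/
def unitRoots (G : Subgroup (Orth d)) : Set (Euc d) :=
  {a | ‖a‖ = 1 ∧ hyperplaneReflection a ∈ G}

theorem IsHyperplaneReflection.exists_unit {s : Orth d} (hs : IsHyperplaneReflection s) :
    ∃ a, ‖a‖ = 1 ∧ s = hyperplaneReflection a := by
  obtain ⟨v, hv, rfl⟩ := hs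
  have hn : ‖v‖ ≠ 0 := norm_ne_zero_iff.2 hv
  refine ⟨‖v‖⁻¹ • v, by rw [norm_smul, norm_inv, norm_norm, inv_mul_cancel₀ hn], ?_⟩
  unfold hyperplaneReflection
  congr! 2
  exact (Submodule.span_singleton_smul_eq (isUnit_iff_ne_zero.2 (inv_ne_zero hn)) v).symm

theorem hyperplaneReflection_mul_mem_rotationSubgroup {G : Subgroup (Orth d)} {a b : Euc d}
    (ha : a ∈ unitRoots G) (hb : b ∈ unitRoots G) :
    hyperplaneReflection a * hyperplaneReflection b ∈ rotationSubgroup G := by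
  refine ⟨G.mul_mem ha.2 hb.2, ?_⟩
  have hdet : ∀ a : Euc d, ‖a‖ = 1 →
      LinearMap.det ((hyperplaneReflection a).toLinearEquiv : Euc d →ₗ[ℝ] Euc d) = -1 := by
    intro a ha
    have h := Submodule.det_reflection (𝕜 := ℝ) (Submodule.span ℝ {a})ᗮ
    rw [Submodule.orthogonal_orthogonal, finrank_span_singleton (by
      rintro rfl
      simp at ha), pow_one] at h
    exact h
  have : ((hyperplaneReflection a * hyperplaneReflection b).toLinearEquiv : Euc d →ₗ[ℝ] Euc d)
      = ((hyperplaneReflection a).toLinearEquiv : Euc d →ₗ[ℝ] Euc d) ∘ₗ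
        ((hyperplaneReflection b).toLinearEquiv : Euc d →ₗ[ℝ] Euc d) := rfl
  rw [this, LinearMap.det_comp, hdet a ha.1, hdet b hb.1]
  norm_num

theorem eq_bot_or_eq_top_of_stable {G : Subgroup (Orth d)}
    (hirr : (inclusionRep G).IsIrreducible) (V : Submodule ℝ (Euc d))
    (hV : ∀ g ∈ G, ∀ v ∈ V, g v ∈ V) : V = ⊥ ∨ V = ⊤ := by
  let W : Subrepresentation (inclusionRep G) := ⟨V, fun g v hv => hV g g.2 v hv⟩
  rcases hirr.eq_bot_or_eq_top W with h | h
  · left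
    exact congrArg Subrepresentation.toSubmodule h
  · right
    exact congrArg Subrepresentation.toSubmodule h

theorem stable_of_stable_hyperplaneReflection {G : Subgroup (Orth d)}
    (hG : IsFiniteReflectionGroup G) (V : Submodule ℝ (Euc d))
    (hV : ∀ a ∈ unitRoots G, ∀ v ∈ V, hyperplaneReflection a v ∈ V) :
    ∀ g ∈ G, ∀ v ∈ V, g v ∈ V := by
  obtain ⟨-, S, hS, hSG⟩ := hG
  suffices h : ∀ g ∈ G, ∀ v, g v ∈ V ↔ v ∈ V from fun g hg v hv => (h g hg v).2 hv
  intro g hg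
  rw [← hSG] at hg
  induction hg using Subgroup.closure_induction with
  | mem s hs =>
    obtain ⟨a, ha, rfl⟩ := (hS s hs).exists_unit
    have haG : a ∈ unitRoots G := ⟨ha, hSG ▸ Subgroup.subset_closure hs⟩
    refine fun v => ⟨fun hv => ?_, hV a haG v⟩
    have := hV a haG _ hv
    rwa [hyperplaneReflection, Submodule.reflection_reflection] at this
  | one => exact fun v => Iff.rfl
  | mul g h _ _ hg hh => exact fun v => (hg (h v)).trans (hh v)
  | inv g _ hg =>
    intro v
    rw [← hg (g⁻¹ v)]
    exact iff_of_eq (congrArg (· ∈ V) (g.apply_symm_apply v))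

theorem span_singleton_ne_top (hd : 3 ≤ d) (x : Euc d) : Submodule.span ℝ {x} ≠ ⊤ := by
  intro h
  have h1 := finrank_span_le_card (R := ℝ) ({x} : Set (Euc d))
  rw [h, finrank_top, finrank_euclideanSpace_fin] at h1
  simp at h1
  omega

theorem span_pair_ne_top (hd : 3 ≤ d) (x y : Euc d) : Submodule.span ℝ {x, y} ≠ ⊤ := by
  intro h
  have h1 := finrank_span_finset_le_card (R := ℝ) ({x, y} : Finset (Euc d))
  rw [Set.finrank, Finset.coe_pair, h, finrank_top, finrank_euclideanSpace_fin] at h1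
  have := Finset.card_le_two (a := x) (b := y)
  omega

theorem exists_ne_zero (hd : 3 ≤ d) : ∃ x : Euc d, x ≠ 0 := by
  have : Nontrivial (Euc d) := Module.nontrivial_of_finrank_pos (R := ℝ) (by
    rw [finrank_euclideanSpace_fin]
    omega)
  exact _root_.exists_ne 0

variable {G : Subgroup (Orth d)}

/-- The span is invariant under the reflections. It cannot vanish: without roots every line would be
invariant, against irreducibility. -/
theorem span_unitRoots (hd : 3 ≤ d) (hG : IsFiniteReflectionGroup G)
    (hirr : (inclusionRep G).IsIrreducible) : Submodule.span ℝ (unitRoots G) = ⊤ := by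
  have hst : ∀ a ∈ unitRoots G, ∀ v ∈ Submodule.span ℝ (unitRoots G),
      hyperplaneReflection a v ∈ Submodule.span ℝ (unitRoots G) := by
    intro a ha v hv
    rw [hyperplaneReflection, hyperplaneReflection_apply ha.1]
    exact Submodule.sub_mem _ hv (Submodule.smul_mem _ _ (Submodule.subset_span ha))
  rcases eq_bot_or_eq_top_of_stable hirr _ (stable_of_stable_hyperplaneReflection hG _ hst)
    with h | h
  · exfalso
    have hempty : ∀ a, a ∉ unitRoots G := by
      intro a ha
      have h0 : a = 0 := by
        have := Submodule.subset_span (R := ℝ) ha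
        rwa [h] at this
      have h1 := ha.1
      rw [h0, norm_zero] at h1
      exact zero_ne_one h1
    obtain ⟨x, hx⟩ := exists_ne_zero hd
    rcases eq_bot_or_eq_top_of_stable hirr _ (stable_of_stable_hyperplaneReflection hG
      (Submodule.span ℝ {x}) (fun a ha => absurd ha (hempty a))) with h | h
    · exact hx (Submodule.span_singleton_eq_bot.1 h)
    · exact span_singleton_ne_top hd x h
  · exact h

theorem exists_unitRoot_notMem (hd : 3 ≤ d) (hG : IsFiniteReflectionGroup G)
    (hirr : (inclusionRep G).IsIrreducible) {V : Submodule ℝ (Euc d)} (hV : V ≠ ⊤) :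
    ∃ a ∈ unitRoots G, a ∉ V := by
  by_contra! h
  apply hV
  rw [eq_top_iff, ← span_unitRoots hd hG hirr]
  exact Submodule.span_le.2 h

/-- A subspace stable under all `t + t⁻¹`, `t` a product of two reflections in `G`, is stable under
the orthogonal projections onto the root lines. -/
theorem inner_smul_mem_of_stable_rotations (hd : 3 ≤ d) (hG : IsFiniteReflectionGroup G)
    (hirr : (inclusionRep G).IsIrreducible) (X : Submodule ℝ (Euc d))
    (hX : ∀ a ∈ unitRoots G, ∀ b ∈ unitRoots G, ∀ v ∈ X,
      hyperplaneReflection a (hyperplaneReflection b v)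
        + hyperplaneReflection b (hyperplaneReflection a v) ∈ X)
    {a v : Euc d} (ha : a ∈ unitRoots G) (hv : v ∈ X) : ⟪a, v⟫_ℝ • a ∈ X := by
  obtain ⟨b, hb, hab⟩ := exists_unitRoot_notMem hd hG hirr (span_singleton_ne_top hd a)
  obtain ⟨c, hc, habc⟩ := exists_unitRoot_notMem hd hG hirr (span_pair_ne_top hd a b)
  exact inner_smul_mem_of_stable X ha.1 hb.1 hc.1 hab habc (hX a ha b hb) (hX a ha c hc) hv

/-- The rotation subgroup of an irreducible reflection group of rank at least three is
irreducible. -/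
theorem eq_bot_or_eq_top_of_stable_rotationSubgroup (hd : 3 ≤ d) (hG : IsFiniteReflectionGroup G)
    (hirr : (inclusionRep G).IsIrreducible) (V : Submodule ℝ (Euc d))
    (hV : ∀ g ∈ rotationSubgroup G, ∀ v ∈ V, g v ∈ V) : V = ⊥ ∨ V = ⊤ := by
  refine eq_bot_or_eq_top_of_stable hirr V (stable_of_stable_hyperplaneReflection hG V ?_)
  intro a ha v hv
  have h := inner_smul_mem_of_stable_rotations hd hG hirr V (fun a ha b hb v hv =>
    V.add_mem (hV _ (hyperplaneReflection_mul_mem_rotationSubgroup ha hb) v hv)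
      (hV _ (hyperplaneReflection_mul_mem_rotationSubgroup hb ha) v hv)) ha hv
  rw [hyperplaneReflection, hyperplaneReflection_apply ha.1, mul_smul]
  exact V.sub_mem hv (V.smul_mem _ h)

theorem eq_zero_of_fixed (hd : 3 ≤ d) (hG : IsFiniteReflectionGroup G)
    (hirr : (inclusionRep G).IsIrreducible) {v : Euc d}
    (hv : ∀ g ∈ rotationSubgroup G, g v = v) : v = 0 := by
  have hst : ∀ g ∈ rotationSubgroup G, ∀ w ∈ Submodule.span ℝ {v},
      g w ∈ Submodule.span ℝ {v} := by
    intro g hg w hw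
    obtain ⟨c, rfl⟩ := Submodule.mem_span_singleton.1 hw
    rw [map_smul, hv g hg]
    exact hw
  rcases eq_bot_or_eq_top_of_stable_rotationSubgroup hd hG hirr _ hst with h | h
  · exact Submodule.span_singleton_eq_bot.1 h
  · exact absurd h (span_singleton_ne_top hd v)

theorem finite_rotationSubgroup (hG : IsFiniteReflectionGroup G) : Finite (rotationSubgroup G) :=
  have := hG.1
  Finite.of_injective (fun g : rotationSubgroup G => (⟨g.1, g.2.1⟩ : G))
    fun _ _ h => Subtype.ext (congrArg (fun x : G => (x : Orth d)) h)

theorem sum_rotationSubgroup_apply (hd : 3 ≤ d) (hG : IsFiniteReflectionGroup G)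
    (hirr : (inclusionRep G).IsIrreducible) [Fintype (rotationSubgroup G)] (u : Euc d) :
    ∑ g : rotationSubgroup G, (g : Orth d) u = 0 := by
  apply eq_zero_of_fixed hd hG hirr
  intro g hg
  rw [map_sum]
  exact Fintype.sum_equiv (Equiv.mulLeft (⟨g, hg⟩ : rotationSubgroup G)) _ _ fun h => rfl

/-- A trivial group would fix every vector. The bound makes the natural-number subtraction `r - 2` a
true one. -/
theorem two_le_card_rotationSubgroup (hd : 3 ≤ d) (hG : IsFiniteReflectionGroup G)
    (hirr : (inclusionRep G).IsIrreducible) : 2 ≤ Nat.card (rotationSubgroup G) := by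
  have := finite_rotationSubgroup hG
  have := Finite.one_lt_card_iff_nontrivial (α := rotationSubgroup G)
  rw [Nat.succ_le_iff, this]
  by_contra h
  rw [not_nontrivial_iff_subsingleton] at h
  obtain ⟨x, hx⟩ := exists_ne_zero hd
  refine hx (eq_zero_of_fixed hd hG hirr fun g hg => ?_)
  have : (⟨g, hg⟩ : rotationSubgroup G) = 1 := Subsingleton.elim _ _
  rw [show g = 1 from congrArg Subtype.val this]
  rfl

end Alternahedra
end

/-! ### Symmetries of generic orbits -/

noncomputable section
namespace Alternahedra

open scoped InnerProductSpace

variable {d : ℕ} {G : Subgroup (Orth d)}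

/-- `u` distinguishes the quadratic forms of the elements of `G`. -/
def IsGenericVector (G : Subgroup (Orth d)) (u : Euc d) : Prop :=
  ∀ g ∈ G, ∀ k ∈ G, ⟪g u, u⟫_ℝ = ⟪k u, u⟫_ℝ → ∀ v, ⟪g v, v⟫_ℝ = ⟪k v, v⟫_ℝ

theorem eq_one_of_inner_apply_self {g : Orth d} (h : ∀ v, ⟪g v, v⟫_ℝ = ⟪v, v⟫_ℝ) : g = 1 := by
  ext1 v
  change g v = v
  rw [← sub_eq_zero, ← norm_eq_zero, ← sq_eq_zero_iff, ← real_inner_self_eq_norm_sq]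
  simp only [inner_sub_left, inner_sub_right, real_inner_comm (g v) v, h,
    LinearIsometryEquiv.inner_map_map]
  ring

theorem IsGenericVector.eq_one {u : Euc d} (hu : IsGenericVector G u) {g : Orth d} (hg : g ∈ G)
    (h : g u = u) : g = 1 :=
  eq_one_of_inner_apply_self (hu g hg 1 G.one_mem (by rw [h]; rfl))

/-- Genericity ranges over all of `G`, so a reflection fixing `u` would be the identity. Thus `u`
lies on no mirror. -/
theorem IsGenericVector.inner_ne_zero {u : Euc d} (hu : IsGenericVector G u) {a : Euc d}
    (ha : a ∈ unitRoots G) : ⟪a, u⟫_ℝ ≠ 0 := by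
  intro h
  have h1 : hyperplaneReflection a = 1 := hu.eq_one ha.2 (by
    rw [hyperplaneReflection, hyperplaneReflection_apply ha.1, h]
    simp)
  have h2 : hyperplaneReflection a a = a := by rw [h1]; rfl
  rw [hyperplaneReflection, hyperplaneReflection_apply ha.1, real_inner_self_eq_norm_sq, ha.1] at h2
  have h3 : a = 0 := by simpa using h2
  have := ha.1
  simp [h3] at this

theorem IsGenericVector.isFreeVector (hd : 3 ≤ d) (hG : IsFiniteReflectionGroup G)
    (hirr : (inclusionRep G).IsIrreducible) {u : Euc d} (hu : IsGenericVector G u) :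
    IsFreeVector (rotationSubgroup G) u := by
  refine ⟨?_, fun g hg h => hu.eq_one hg.1 h⟩
  rintro rfl
  obtain ⟨a, ha, -⟩ := exists_unitRoot_notMem hd hG hirr (span_singleton_ne_top hd 0)
  exact hu.inner_ne_zero ha (inner_zero_right a)

theorem IsFreeVector.apply_injective {H : Subgroup (Orth d)} {u : Euc d} (hu : IsFreeVector H u)
    {g k : Orth d} (hg : g ∈ H) (hk : k ∈ H) (h : g u = k u) : g = k := by
  have : k⁻¹ * g = 1 := by
    apply hu.2 _ (H.mul_mem (H.inv_mem hk) hg)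
    change k.symm (g u) = u
    rw [h, k.symm_apply_apply]
  exact (inv_mul_eq_one.1 this).symm

/-- A linear isometry fixing a generic vector and permuting its orbit under the rotation subgroup
is the identity. -/
theorem IsGenericVector.eq_one_of_permutes_orbit (hd : 3 ≤ d) (hG : IsFiniteReflectionGroup G)
    (hirr : (inclusionRep G).IsIrreducible) {u : Euc d} (hu : IsGenericVector G u) (h : Orth d)
    (hfix : h u = u)
    (hperm : ∀ g ∈ rotationSubgroup G, ∃ g' ∈ rotationSubgroup G, h (g u) = g' u) : h = 1 := by
  have hfree := hu.isFreeVector hd hG hirr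
  choose! σ hσ hσu using hperm
  -- `X` collects the vectors on which `h g` and `σ g` agree for all rotations `g`. It contains `u`;
  -- the aim is to show that it is the whole space.
  let X : Submodule ℝ (Euc d) :=
    { carrier := {v | ∀ g ∈ rotationSubgroup G, h (g v) = σ g v}
      add_mem' := fun hv hw g hg => by simp only [map_add, hv g hg, hw g hg]
      zero_mem' := fun g _ => by simp only [map_zero]
      smul_mem' := fun c v hv g hg => by simp only [map_smul, hv g hg] }
  have huX : u ∈ X := hσu
  have hX : ∀ a ∈ unitRoots G, ∀ b ∈ unitRoots G, ∀ v ∈ X,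
      hyperplaneReflection a (hyperplaneReflection b v)
        + hyperplaneReflection b (hyperplaneReflection a v) ∈ X := by
    have key : ∀ a ∈ unitRoots G, ∀ b ∈ unitRoots G, ∀ g ∈ rotationSubgroup G,
        (∀ v, σ (g * (hyperplaneReflection a * hyperplaneReflection b)) v
          = σ g (hyperplaneReflection a (hyperplaneReflection b v))) ∨
        (∀ v, σ (g * (hyperplaneReflection a * hyperplaneReflection b)) v
          = σ g (hyperplaneReflection b (hyperplaneReflection a v))) := by
      intro a ha b hb g hg
      have ht := hyperplaneReflection_mul_mem_rotationSubgroup ha hb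
      set t := hyperplaneReflection a * hyperplaneReflection b with ht_def
      have hgt := (rotationSubgroup G).mul_mem hg ht
      have hk := (rotationSubgroup G).mul_mem ((rotationSubgroup G).inv_mem (hσ g hg)) (hσ _ hgt)
      have hσk : ∀ v, σ (g * t) v = σ g (((σ g)⁻¹ * σ (g * t)) v) := fun v =>
        ((σ g).apply_symm_apply _).symm
      -- As `h` and `g` are isometries, `(σ g)⁻¹ * σ (g * t)` and `t` have the same form value at
      -- `u`, so genericity identifies their forms.
      have hform := hu _ hk.1 t ht.1 (by
        rw [← (σ g).inner_map_map, ← hσk, ← hσu _ hgt, ← hσu g hg, h.inner_map_map]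
        exact g.inner_map_map _ _)
      refine (eq_reflection_comp_or_of_inner_eq ha.1 hb.1 _ hform).imp (fun H v => ?_)
        (fun H v => ?_)
      · rw [hσk, H]
        rfl
      · rw [hσk, H]
        rfl
    intro a ha b hb v hv g hg
    have hab := hyperplaneReflection_mul_mem_rotationSubgroup ha hb
    have hba := hyperplaneReflection_mul_mem_rotationSubgroup hb ha
    have hgab := (rotationSubgroup G).mul_mem hg hab
    have hgba := (rotationSubgroup G).mul_mem hg hba
    have e1 := hv _ hgab
    have e2 := hv _ hgba
    -- If t and t⁻¹ both led to the same choice, freeness of the orbit would give t = t⁻¹. So in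
    -- every case `σ (g * t) + σ (g * t⁻¹)` equals `σ g` applied to t + t⁻¹.
    have hcollapse : σ (g * (hyperplaneReflection a * hyperplaneReflection b)) u
        = σ (g * (hyperplaneReflection b * hyperplaneReflection a)) u →
        hyperplaneReflection a * hyperplaneReflection b
          = hyperplaneReflection b * hyperplaneReflection a := by
      intro heq
      rw [← hσu _ hgab, ← hσu _ hgba] at heq
      exact hfree.apply_injective hab hba (g.injective (h.injective heq))
    have e : h (g (hyperplaneReflection a (hyperplaneReflection b v)
        + hyperplaneReflection b (hyperplaneReflection a v)))
        = σ (g * (hyperplaneReflection a * hyperplaneReflection b)) v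
          + σ (g * (hyperplaneReflection b * hyperplaneReflection a)) v := by
      rw [map_add, map_add, ← e1, ← e2]
      rfl
    rw [e, map_add]
    rcases key a ha b hb g hg with h1 | h1 <;> rcases key b hb a ha g hg with h2 | h2
    · rw [h1, h2]
    · have hc := hcollapse (by rw [h1, h2])
      have hc' := DFunLike.congr_fun hc v
      change hyperplaneReflection a (hyperplaneReflection b v)
        = hyperplaneReflection b (hyperplaneReflection a v) at hc'
      rw [h1, h2, hc']
    · have hc := hcollapse (by rw [h1, h2])
      have hc' := DFunLike.congr_fun hc v
      change hyperplaneReflection a (hyperplaneReflection b v)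
        = hyperplaneReflection b (hyperplaneReflection a v) at hc'
      rw [h1, h2, hc']
    · rw [h1, h2, add_comm]
  have hXtop : X = ⊤ := by
    rw [eq_top_iff, ← span_unitRoots hd hG hirr]
    refine Submodule.span_le.2 fun a ha => ?_
    exact (X.smul_mem_iff (hu.inner_ne_zero ha)).1
      (inner_smul_mem_of_stable_rotations hd hG hirr X hX ha huX)
  have h1 := (rotationSubgroup G).one_mem
  have hσ1 : σ 1 = 1 := hfree.2 _ (hσ 1 h1) (by rw [← hσu 1 h1]; exact hfix)
  ext1 v
  have hv : v ∈ X := hXtop ▸ Submodule.mem_top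
  have := hv 1 h1
  rw [hσ1] at this
  exact this

/-! ### Orbit polytopes -/

/-- The orbit lies on a sphere about `a`. A proper segment in the closed ball has its interior in
the open ball, so no orbit point is inside one. -/
theorem extremePoints_orbitPolytope (H : Subgroup (Orth d)) (u a : Euc d) :
    (orbitPolytope H u a).extremePoints ℝ = {x | ∃ g ∈ H, x = a + g u} := by
  refine Set.Subset.antisymm extremePoints_convexHull_subset ?_
  have hball : orbitPolytope H u a ⊆ Metric.closedBall a ‖u‖ := by
    refine convexHull_min ?_ (convex_closedBall a ‖u‖)
    rintro x ⟨g, -, rfl⟩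
    simp
  rintro x ⟨g, hg, rfl⟩
  refine mem_extremePoints.2 ⟨subset_convexHull ℝ _ ⟨g, hg, rfl⟩, ?_⟩
  intro x₁ hx₁ x₂ hx₂ hx
  have heq : x₁ = x₂ := by
    by_contra hne
    have := openSegment_subset_ball_of_ne (hball hx₁) (hball hx₂) hne hx
    simp at this
  subst heq
  rw [openSegment_same] at hx
  exact ⟨hx.symm, hx.symm⟩

theorem setOf_orbit_eq_range (H : Subgroup (Orth d)) (u a : Euc d) :
    {x | ∃ g ∈ H, x = a + g u} = Set.range fun g : H => a + (g : Orth d) u := by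
  ext x
  constructor
  · rintro ⟨g, hg, rfl⟩
    exact ⟨⟨g, hg⟩, rfl⟩
  · rintro ⟨g, rfl⟩
    exact ⟨g, g.2, rfl⟩

theorem IsFreeVector.orbit_injective {H : Subgroup (Orth d)} {u : Euc d} (hu : IsFreeVector H u)
    (a : Euc d) : Function.Injective fun g : H => a + (g : Orth d) u :=
  fun g k h => Subtype.ext (hu.apply_injective g.2 k.2 (add_left_cancel h))

theorem isFullPolytope_orbitPolytope (hd : 3 ≤ d) (hG : IsFiniteReflectionGroup G)
    (hirr : (inclusionRep G).IsIrreducible) {u : Euc d}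
    (hu : IsFreeVector (rotationSubgroup G) u) (a : Euc d) :
    IsFullPolytope (Nat.card (rotationSubgroup G)) (orbitPolytope (rotationSubgroup G) u a) := by
  have := finite_rotationSubgroup hG
  have := Fintype.ofFinite (rotationSubgroup G)
  refine ⟨⟨_, ?_, rfl⟩, ?_, ?_⟩
  · rw [setOf_orbit_eq_range]
    exact Set.finite_range _
  · rw [orbitPolytope, affineSpan_convexHull]
    set O := {x | ∃ g ∈ rotationSubgroup G, x = a + g u} with hO
    have hmem : ∀ g ∈ rotationSubgroup G, a + g u ∈ affineSpan ℝ O := fun g hg =>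
      subset_affineSpan ℝ _ ⟨g, hg, rfl⟩
    set D := (affineSpan ℝ O).direction with hD
    have hdiff : ∀ g ∈ rotationSubgroup G, ∀ k ∈ rotationSubgroup G, g u - k u ∈ D := by
      intro g hg k hk
      have := AffineSubspace.vsub_mem_direction (hmem g hg) (hmem k hk)
      simpa using this
    have hgD : ∀ g ∈ rotationSubgroup G, g u ∈ D := by
      intro g hg
      -- The orbit sums to zero, so summing these differences over `k` leaves a positive multiple of
      -- `g u`.
      have h1 : ∑ k : rotationSubgroup G, (g u - (k : Orth d) u) ∈ D :=
        D.sum_mem fun k _ => hdiff g hg k k.2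
      rw [Finset.sum_sub_distrib, sum_rotationSubgroup_apply hd hG hirr, sub_zero,
        Finset.sum_const, Finset.card_univ, ← Nat.cast_smul_eq_nsmul ℝ] at h1
      exact (D.smul_mem_iff (Nat.cast_ne_zero.2 Fintype.card_ne_zero)).1 h1
    have hspan : Submodule.span ℝ {x | ∃ g ∈ rotationSubgroup G, x = g u} ≤ D := by
      rw [Submodule.span_le]
      rintro x ⟨g, hg, rfl⟩
      exact hgD g hg
    have hstab : ∀ g ∈ rotationSubgroup G,
        ∀ v ∈ Submodule.span ℝ {x | ∃ g ∈ rotationSubgroup G, x = g u},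
        g v ∈ Submodule.span ℝ {x | ∃ g ∈ rotationSubgroup G, x = g u} := by
      intro g hg v hv
      induction hv using Submodule.span_induction with
      | mem x hx =>
        obtain ⟨k, hk, rfl⟩ := hx
        exact Submodule.subset_span ⟨g * k, (rotationSubgroup G).mul_mem hg hk, rfl⟩
      | zero => simp
      | add x y _ _ hx hy =>
        rw [map_add]
        exact Submodule.add_mem _ hx hy
      | smul c x _ hx =>
        rw [map_smul]
        exact Submodule.smul_mem _ _ hx
    have hDtop : D = ⊤ := by
      rcases eq_bot_or_eq_top_of_stable_rotationSubgroup hd hG hirr _ hstab with h | h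
      · exfalso
        have hu' : u ∈ Submodule.span ℝ {x | ∃ g ∈ rotationSubgroup G, x = g u} :=
          Submodule.subset_span ⟨1, (rotationSubgroup G).one_mem, rfl⟩
        rw [h] at hu'
        exact hu.1 hu'
      · rw [h] at hspan
        exact top_le_iff.1 hspan
    exact (AffineSubspace.direction_eq_top_iff_of_nonempty
      ⟨_, hmem 1 (rotationSubgroup G).one_mem⟩).1 hDtop
  · rw [extremePoints_orbitPolytope, setOf_orbit_eq_range, ← Set.image_univ,
      Set.ncard_image_of_injective _ (hu.orbit_injective a), Set.ncard_univ]

theorem image_orbitPolytope {H : Subgroup (Orth d)} {u a : Euc d} {φ : Euc d ≃ᵢ Euc d}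
    (hφ : φ ∈ actionAround H a) : φ '' orbitPolytope H u a ⊆ orbitPolytope H u a := by
  obtain ⟨g, hg, hφg⟩ := hφ
  rintro _ ⟨x, hx, rfl⟩
  have haff : ⇑φ = φ.toRealAffineIsometryEquiv.toAffineEquiv.toAffineMap := rfl
  rw [haff]
  have h1 : φ.toRealAffineIsometryEquiv.toAffineEquiv.toAffineMap x ∈
    φ.toRealAffineIsometryEquiv.toAffineEquiv.toAffineMap '' orbitPolytope H u a := ⟨x, hx, rfl⟩
  rw [orbitPolytope, AffineMap.image_convexHull, ← haff] at h1
  refine convexHull_mono ?_ h1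
  rintro _ ⟨_, ⟨k, hk, rfl⟩, rfl⟩
  refine ⟨g * k, H.mul_mem hg hk, ?_⟩
  rw [hφg, add_sub_cancel_left]
  rfl

theorem image_eq_of_mem_isoGroup_orbit {H : Subgroup (Orth d)} {u a : Euc d} {φ : Euc d ≃ᵢ Euc d}
    (hφ : φ ∈ isoGroup (orbitPolytope H u a)) {g : Orth d} (hg : g ∈ H) :
    ∃ k ∈ H, φ (a + g u) = a + k u := by
  have hφP : φ '' orbitPolytope H u a = orbitPolytope H u a := hφ
  have hx : a + g u ∈ (orbitPolytope H u a).extremePoints ℝ := by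
    rw [extremePoints_orbitPolytope]
    exact ⟨g, hg, rfl⟩
  have hy : φ (a + g u) ∈ (orbitPolytope H u a).extremePoints ℝ := by
    rw [mem_extremePoints] at hx ⊢
    refine ⟨hφP ▸ ⟨_, hx.1, rfl⟩, ?_⟩
    intro x₁ hx₁ x₂ hx₂ hseg
    rw [← hφP] at hx₁ hx₂
    obtain ⟨y₁, hy₁, rfl⟩ := hx₁
    obtain ⟨y₂, hy₂, rfl⟩ := hx₂
    have haff : ⇑φ = φ.toRealAffineIsometryEquiv.toAffineEquiv.toAffineMap := rfl
    rw [haff, ← image_openSegment, ← haff] at hseg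
    have := hx.2 y₁ hy₁ y₂ hy₂ ((φ.injective.mem_set_image).1 hseg)
    exact ⟨congrArg φ this.1, congrArg φ this.2⟩
  rw [extremePoints_orbitPolytope] at hy
  exact hy

/-- The isometry group of a generic Coxeter alternahedron is the rotation group acting around its
centre. -/
theorem isoGroup_orbitPolytope (hd : 3 ≤ d) (hG : IsFiniteReflectionGroup G)
    (hirr : (inclusionRep G).IsIrreducible) {u : Euc d} (hu : IsGenericVector G u) (a : Euc d) :
    isoGroup (orbitPolytope (rotationSubgroup G) u a) = actionAround (rotationSubgroup G) a := by
  have := finite_rotationSubgroup hG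
  have := Fintype.ofFinite (rotationSubgroup G)
  have hfree := hu.isFreeVector hd hG hirr
  refine le_antisymm ?_ ?_
  · intro φ hφ
    set h : Orth d := φ.toRealAffineIsometryEquiv.linearIsometryEquiv with hh
    have hφh : ∀ x y, φ x = φ y + h (x - y) := by
      intro x y
      have := φ.toRealAffineIsometryEquiv.map_vadd y (x - y)
      rw [vadd_eq_add, vadd_eq_add, sub_add_cancel, add_comm] at this
      exact this
    choose τ hτ hτu using
      fun g : rotationSubgroup G => image_eq_of_mem_isoGroup_orbit hφ g.2
    let τ' : rotationSubgroup G → rotationSubgroup G := fun g => ⟨τ g, hτ g⟩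
    have hτinj : Function.Injective τ' := by
      intro g k hgk
      have h1 : τ g = τ k := congrArg Subtype.val hgk
      have h2 : φ (a + (g : Orth d) u) = φ (a + (k : Orth d) u) := by rw [hτu, hτu, h1]
      exact hfree.orbit_injective a (φ.injective h2)
    have hsum : ∑ g : rotationSubgroup G, (a + (τ' g : Orth d) u)
        = ∑ g : rotationSubgroup G, (a + (g : Orth d) u) :=
      Function.Bijective.sum_comp (Finite.injective_iff_bijective.1 hτinj)
        fun g : rotationSubgroup G => a + (g : Orth d) u
    -- An affine map permuting the vertices fixes their barycentre, which is `a`.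
    have hfixa : φ a = a := by
      have h1 : ∑ g : rotationSubgroup G, φ (a + (g : Orth d) u)
          = ∑ g : rotationSubgroup G, (a + (g : Orth d) u) := by
        rw [← hsum]
        exact Finset.sum_congr rfl fun g _ => hτu g
      have h2 : ∀ g : rotationSubgroup G, φ (a + (g : Orth d) u) = φ a + h ((g : Orth d) u) := by
        intro g
        rw [hφh _ a, add_sub_cancel_left]
      simp only [h2] at h1
      rw [Finset.sum_add_distrib, Finset.sum_add_distrib, ← map_sum h,
        sum_rotationSubgroup_apply hd hG hirr, map_zero, add_zero, add_zero, Finset.sum_const,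
        Finset.sum_const, ← Nat.cast_smul_eq_nsmul ℝ, ← Nat.cast_smul_eq_nsmul ℝ] at h1
      exact smul_right_injective _ (Nat.cast_ne_zero.2 (by
        rw [Finset.card_univ]
        exact Fintype.card_ne_zero)) h1
    have hφa : ∀ x, φ x = a + h (x - a) := fun x => by rw [hφh x a, hfixa]
    have hperm : ∀ g ∈ rotationSubgroup G, ∃ g' ∈ rotationSubgroup G, h (g u) = g' u := by
      intro g hg
      obtain ⟨k, hk, hgk⟩ := image_eq_of_mem_isoGroup_orbit hφ hg
      rw [hφa, add_sub_cancel_left] at hgk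
      exact ⟨k, hk, add_left_cancel hgk⟩
    obtain ⟨g₀, hg₀, hhu⟩ := hperm 1 (rotationSubgroup G).one_mem
    change h u = g₀ u at hhu
    -- Composing with `g₀⁻¹` gives a symmetry fixing `u`, to which the rigidity of the orbit
    -- applies.
    have h1 : g₀⁻¹ * h = 1 := by
      refine hu.eq_one_of_permutes_orbit hd hG hirr _ ?_ ?_
      · change g₀.symm (h u) = u
        rw [hhu, g₀.symm_apply_apply]
      · intro g hg
        obtain ⟨k, hk, hgk⟩ := hperm g hg
        refine ⟨g₀⁻¹ * k, (rotationSubgroup G).mul_mem ((rotationSubgroup G).inv_mem hg₀) hk, ?_⟩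
        exact congrArg g₀.symm hgk
    have h2 : g₀ = h := inv_mul_eq_one.1 h1
    exact ⟨h, h2 ▸ hg₀, hφa⟩
  · intro φ hφ
    refine Set.Subset.antisymm (image_orbitPolytope hφ) ?_
    intro x hx
    refine ⟨φ⁻¹ x, image_orbitPolytope ((actionAround (rotationSubgroup G) a).inv_mem hφ)
      ⟨x, hx, rfl⟩, φ.apply_symm_apply x⟩

end Alternahedra
end

/-! ### Colorful Carathéodory and Sarkaria's trick -/

noncomputable section
namespace Alternahedra

open scoped InnerProductSpace

section Colorful

variable {ι κ : Type*} [Fintype ι] [Fintype κ]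

theorem inner_self_le_inner_of_norm_le {E : Type*} [NormedAddCommGroup E] [InnerProductSpace ℝ E]
    {p w : E} (h : ∀ t : ℝ, 0 ≤ t → t ≤ 1 → ‖p‖ ≤ ‖(1 - t) • p + t • w‖) :
    ⟪p, p⟫_ℝ ≤ ⟪p, w⟫_ℝ := by
  by_contra! hlt
  set m := ⟪p, w⟫_ℝ - ⟪p, p⟫_ℝ with hm
  have hm0 : m < 0 := by linarith
  have hexp : ∀ t : ℝ, ‖(1 - t) • p + t • w‖ ^ 2 = ‖p‖ ^ 2 + 2 * t * m + t ^ 2 * ‖w - p‖ ^ 2 := by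
    intro t
    simp only [← real_inner_self_eq_norm_sq, hm, inner_add_left, inner_add_right, inner_sub_left,
      inner_sub_right, inner_smul_left, inner_smul_right, RCLike.conj_to_real, real_inner_comm p w]
    ring
  set q := ‖w - p‖ ^ 2 with hq
  have hq0 : 0 ≤ q := by positivity
  have hpos : 0 < q - m := by linarith
  -- The squared norm along the segment has slope 2m < 0 at `p`. This choice of t lies in (0, 1] and
  -- satisfies tq ≤ -m, so the change 2tm + t²q is at most tm < 0.
  have ht0 : 0 < -m / (q - m) := div_pos (by linarith) hpos
  have ht1 : -m / (q - m) ≤ 1 := (div_le_one hpos).2 (by linarith)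
  have h1 := pow_le_pow_left₀ (norm_nonneg p) (h _ ht0.le ht1) 2
  rw [hexp] at h1
  set t := -m / (q - m) with ht
  have htq : t * q ≤ -m := by
    have : t * (q - m) = -m := div_mul_cancel₀ _ hpos.ne'
    nlinarith
  nlinarith

/-- Removing one summand from a positive combination of linearly dependent vectors on an affine
hyperplane. -/
theorem exists_stdSimplex_eq_zero {E : Type*} [AddCommGroup E] [Module ℝ E]
    [FiniteDimensional ℝ E] (hE : Module.finrank ℝ E < Fintype.card ι) (v : ι → E)
    (f : E →ₗ[ℝ] ℝ) {m : ℝ} (hm : m ≠ 0) (hf : ∀ i, f (v i) = m) {l : ι → ℝ}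
    (hl : l ∈ stdSimplex ℝ ι) :
    ∃ l' ∈ stdSimplex ℝ ι, ∑ i, l' i • v i = ∑ i, l i • v i ∧ ∃ i, l' i = 0 := by
  have hdep : ¬ LinearIndependent ℝ v := fun h => by
    have := h.fintype_card_le_finrank
    omega
  obtain ⟨g, hg, i₀, hi₀⟩ := Fintype.not_linearIndependent_iff.1 hdep
  -- Applying `f` to the dependency shows that moving along `g` keeps the total weight.
  have hg0 : ∑ i, g i = 0 := by
    have := congrArg f hg
    simp only [map_sum, map_smul, hf, smul_eq_mul, map_zero, ← Finset.sum_mul] at this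
    exact (mul_eq_zero.1 this).resolve_right hm
  obtain ⟨i₁, -, hi₁⟩ := Finset.exists_pos_of_sum_zero_of_exists_nonzero g hg0
    ⟨i₀, Finset.mem_univ _, hi₀⟩
  -- The smallest ratio is the largest step that keeps all weights nonnegative, and it annihilates
  -- one of them.
  obtain ⟨i, hi, hmin⟩ := Finset.exists_min_image (Finset.univ.filter fun i => 0 < g i)
    (fun i => l i / g i) ⟨i₁, by simp [hi₁]⟩
  have hgi : 0 < g i := by simpa using hi
  have hs0 : 0 ≤ l i / g i := div_nonneg (hl.1 i) hgi.le
  refine ⟨fun j => l j - l i / g i * g j, ⟨fun j => ?_, ?_⟩, ?_, i, ?_⟩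
  · rcases le_or_gt (g j) 0 with hj | hj
    · have := mul_nonpos_of_nonneg_of_nonpos hs0 hj
      have := hl.1 j
      linarith
    · have := hmin j (by simp [hj])
      rw [le_div_iff₀ hj] at this
      linarith
  · rw [Finset.sum_sub_distrib, ← Finset.mul_sum, hg0, hl.2]
    ring
  · simp only [sub_smul, mul_smul, Finset.sum_sub_distrib, ← Finset.smul_sum, hg]
    simp
  · change l i - l i / g i * g i = 0
    rw [div_mul_cancel₀ _ hgi.ne', sub_self]

theorem exists_colorful_sum_eq_zero_of_innerProductSpace {E : Type*} [NormedAddCommGroup E]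
    [InnerProductSpace ℝ E] [FiniteDimensional ℝ E] [Nonempty κ]
    (hE : Module.finrank ℝ E < Fintype.card ι) (v : ι → κ → E) (hv : ∀ i, ∑ k, v i k = 0) :
    ∃ c : ι → κ, ∃ l ∈ stdSimplex ℝ ι, ∑ i, l i • v i (c i) = 0 := by
  classical
  have : Nonempty ι := Fintype.card_pos_iff.1 (by omega)
  have hne : (stdSimplex ℝ ι).Nonempty := ⟨_, single_mem_stdSimplex ℝ (Classical.arbitrary ι)⟩
  have hmin : ∀ c : ι → κ, ∃ l ∈ stdSimplex ℝ ι, ∀ l' ∈ stdSimplex ℝ ι,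
      ‖∑ i, l i • v i (c i)‖ ≤ ‖∑ i, l' i • v i (c i)‖ := by
    intro c
    obtain ⟨l, hl, hmin⟩ := (isCompact_stdSimplex ℝ ι).exists_isMinOn hne
      (f := fun l : ι → ℝ => ‖∑ i, l i • v i (c i)‖) (by fun_prop)
    exact ⟨l, hl, fun l' hl' => hmin hl'⟩
  choose L hL hLmin using hmin
  -- Take the point `p` of least norm over all colourings and all weights. If `p ≠ 0`, some colour
  -- can be exchanged to contradict minimality.
  obtain ⟨c, hc⟩ := Finite.exists_min fun c : ι → κ => ‖∑ i, L c i • v i (c i)‖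
  have hglob : ∀ c' : ι → κ, ∀ l' ∈ stdSimplex ℝ ι,
      ‖∑ i, L c i • v i (c i)‖ ≤ ‖∑ i, l' i • v i (c' i)‖ := fun c' l' hl' =>
    (hc c').trans (hLmin c' l' hl')
  set p := ∑ i, L c i • v i (c i) with hp
  have hmove : ∀ c' : ι → κ, ∀ l' ∈ stdSimplex ℝ ι, ∑ i, l' i • v i (c' i) = p →
      ∀ i, ⟪p, p⟫_ℝ ≤ ⟪p, v i (c' i)⟫_ℝ := by
    intro c' l' hl' hpl' i
    apply inner_self_le_inner_of_norm_le
    intro t ht0 ht1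
    have hmem : (1 - t) • l' + t • Pi.single i 1 ∈ stdSimplex ℝ ι :=
      convex_stdSimplex ℝ ι hl' (single_mem_stdSimplex ℝ i) (by linarith) ht0 (by ring)
    have := hglob c' _ hmem
    convert this using 2
    simp only [Pi.add_apply, Pi.smul_apply, add_smul, smul_eq_mul, mul_smul,
      Finset.sum_add_distrib, ← Finset.smul_sum, hpl']
    congr 2
    simp [Pi.single_apply]
  refine ⟨c, L c, hL c, ?_⟩
  by_contra hp0
  rw [← hp] at hp0
  have hpp : 0 < ⟪p, p⟫_ℝ := real_inner_self_pos.2 hp0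
  -- If all weights are positive, minimality puts every chosen vector on the hyperplane `⟪p, ·⟫ =
  -- ⟪p, p⟫`, where a linear dependency frees one index.
  obtain ⟨l, hl, hlp, i, hi⟩ : ∃ l ∈ stdSimplex ℝ ι, ∑ i, l i • v i (c i) = p ∧ ∃ i, l i = 0 := by
    by_cases h0 : ∃ i, L c i = 0
    · exact ⟨L c, hL c, rfl, h0⟩
    push Not at h0
    have hge := hmove c (L c) (hL c) rfl
    have hsum : ∑ i, L c i * (⟪p, v i (c i)⟫_ℝ - ⟪p, p⟫_ℝ) = 0 := by
      have h1 : ∑ i, L c i * ⟪p, v i (c i)⟫_ℝ = ⟪p, p⟫_ℝ := by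
        conv_rhs => rw [hp, inner_sum]
        exact Finset.sum_congr rfl fun i _ => (inner_smul_right _ _ _).symm
      simp only [mul_sub, Finset.sum_sub_distrib, h1, ← Finset.sum_mul, (hL c).2]
      ring
    have heq : ∀ i, ⟪p, v i (c i)⟫_ℝ = ⟪p, p⟫_ℝ := by
      intro i
      have := (Finset.sum_eq_zero_iff_of_nonneg fun i _ =>
        mul_nonneg ((hL c).1 i) (sub_nonneg.2 (hge i))).1 hsum i (Finset.mem_univ i)
      exact sub_eq_zero.1 ((mul_eq_zero.1 this).resolve_left (h0 i))
    exact exists_stdSimplex_eq_zero hE (fun i => v i (c i)) (innerₗ E p) hpp.ne' heq (hL c)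
  obtain ⟨k, hk⟩ : ∃ k, ⟪p, v i k⟫_ℝ ≤ 0 := by
    by_contra! hpos
    have h1 : 0 < ∑ k, ⟪p, v i k⟫_ℝ :=
      Finset.sum_pos (fun k _ => hpos k) Finset.univ_nonempty
    rw [← inner_sum, hv, inner_zero_right] at h1
    exact lt_irrefl _ h1
  -- Index `i` has weight zero, so recolouring it leaves `p` unchanged, yet minimality now demands
  -- `⟪p, v i k⟫ ≥ ⟪p, p⟫ > 0`.
  have h2 := hmove (Function.update c i k) l hl (by
    rw [← hlp]
    refine Finset.sum_congr rfl fun j _ => ?_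
    rcases eq_or_ne j i with rfl | hj
    · simp [hi]
    · rw [Function.update_of_ne hj]) i
  rw [Function.update_self] at h2
  linarith

/-- Colorful Carathéodory, for color classes whose barycenter is the origin. -/
theorem exists_colorful_sum_eq_zero {V : Type*} [AddCommGroup V] [Module ℝ V]
    [FiniteDimensional ℝ V] [Nonempty κ] (hV : Module.finrank ℝ V < Fintype.card ι)
    (v : ι → κ → V) (hv : ∀ i, ∑ k, v i k = 0) :
    ∃ c : ι → κ, ∃ l ∈ stdSimplex ℝ ι, ∑ i, l i • v i (c i) = 0 := by
  let e : V ≃ₗ[ℝ] EuclideanSpace ℝ (Fin (Module.finrank ℝ V)) :=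
    LinearEquiv.ofFinrankEq _ _ finrank_euclideanSpace_fin.symm
  obtain ⟨c, l, hl, h⟩ := exists_colorful_sum_eq_zero_of_innerProductSpace
    (by rwa [finrank_euclideanSpace_fin]) (fun i k => e (v i k))
    (fun i => by rw [← map_sum, hv, map_zero])
  refine ⟨c, l, hl, e.injective ?_⟩
  rw [map_sum, map_zero, ← h]
  simp only [map_smul]

end Colorful

variable {d : ℕ}

open Classical in
/-- Sarkaria's linear-algebraic trick for free orbits: enough points can be coloured by `H` so that
suitable convex combinations of the colour classes form an orbit of `H` around some centre. -/
theorem exists_coloring_orbit (H : Subgroup (Orth d)) [Fintype H]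
    (hH : ∀ v : Euc d, (∀ g ∈ H, g v = v) → v = 0) {N : ℕ}
    (hN : Fintype.card H * (d + 1) ≤ N + 2 * d) (z : Fin N → Euc d) :
    ∃ (c : Fin N → H) (l : Fin N → ℝ), (∀ j, 0 ≤ l j) ∧
      (∀ g, ∑ j with c j = g, l j = 1) ∧
      ∃ a u : Euc d, ∀ g : H, ∑ j with c j = g, l j • z j = a + (g : Orth d) u := by
  let Ψ : (Euc d × Euc d × ℝ) →ₗ[ℝ] (H → Euc d × ℝ) :=
    { toFun := fun x g => (x.1 + (g : Orth d) x.2.1, x.2.2)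
      map_add' := fun x y => by
        ext1 g
        simp only [Prod.fst_add, Prod.snd_add, map_add, Pi.add_apply, Prod.mk_add_mk]
        congr 1
        abel
      map_smul' := fun t x => by
        ext1 g
        simp }
  have hΨ : Function.Injective Ψ := by
    rw [← LinearMap.ker_eq_bot, LinearMap.ker_eq_bot']
    rintro ⟨a, u, s⟩ h
    have hg : ∀ g : H, a + (g : Orth d) u = 0 ∧ s = 0 := fun g =>
      Prod.ext_iff.1 (congrFun h g)
    have h1 : a + u = 0 := (hg 1).1
    have hu : u = 0 := hH u fun g hgH => by
      have := (hg ⟨g, hgH⟩).1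
      exact add_left_cancel (this.trans h1.symm)
    subst hu
    rw [add_zero] at h1
    rw [h1, (hg 1).2]
    rfl
  have hrank := (LinearMap.range Ψ).finrank_quotient_add_finrank
  rw [LinearMap.finrank_range_of_inj hΨ, Module.finrank_pi_fintype] at hrank
  simp only [Module.finrank_prod, finrank_euclideanSpace_fin, Module.finrank_self,
    Finset.sum_const, Finset.card_univ, smul_eq_mul] at hrank
  -- The copies of `z j` in all slots add up to a constant family, which is `Ψ (z j, 0, 1)` and so
  -- vanishes in the quotient.
  obtain ⟨c, l, hl, h⟩ := exists_colorful_sum_eq_zero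
    (V := (H → Euc d × ℝ) ⧸ LinearMap.range Ψ) (ι := Fin N) (κ := H)
    (by rw [Fintype.card_fin]; omega)
    (fun j g => (LinearMap.range Ψ).mkQ (Pi.single g (z j, 1))) (fun j => by
      rw [← map_sum, Submodule.mkQ_apply, Submodule.Quotient.mk_eq_zero]
      refine ⟨(z j, 0, 1), ?_⟩
      ext1 g
      rw [Finset.univ_sum_single (fun _ : H => (z j, (1 : ℝ)))]
      simp [Ψ])
  simp only [← map_smul, ← map_sum] at h
  rw [Submodule.mkQ_apply, Submodule.Quotient.mk_eq_zero] at h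
  obtain ⟨⟨a, u, s⟩, hΨx⟩ := h
  have hg : ∀ g : H, a + (g : Orth d) u = ∑ j with c j = g, l j • z j ∧
      s = ∑ j with c j = g, l j := by
    intro g
    have h1 := congrFun hΨx g
    change (a + (g : Orth d) u, s) = _ at h1
    rw [Finset.sum_apply] at h1
    rw [Finset.sum_filter, Finset.sum_filter]
    refine ⟨(congrArg Prod.fst h1).trans ?_, (congrArg Prod.snd h1).trans ?_⟩
    · rw [Prod.fst_sum]
      refine Finset.sum_congr rfl fun j _ => ?_
      by_cases hj : c j = g
      · subst hj
        simp
      · simp [hj]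
    · rw [Prod.snd_sum]
      refine Finset.sum_congr rfl fun j _ => ?_
      by_cases hj : c j = g
      · subst hj
        simp
      · simp [hj]
  -- The extra real coordinate gives each class the same total weight `s`; rescaling by the group
  -- order makes it 1.
  have hs : (Fintype.card H : ℝ) * s = 1 := by
    rw [← hl.2, ← Finset.sum_fiberwise Finset.univ c l]
    simp only [← fun g => (hg g).2]
    simp
  refine ⟨c, fun j => Fintype.card H * l j, fun j => mul_nonneg (Nat.cast_nonneg _) (hl.1 j),
    fun g => ?_, (Fintype.card H : ℝ) • a, (Fintype.card H : ℝ) • u, fun g => ?_⟩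
  · rw [← Finset.mul_sum, ← (hg g).2, hs]
  · simp only [mul_smul, ← Finset.smul_sum, ← (hg g).1, smul_add, map_smul]

end Alternahedra
end

/-! ### Non-generic configurations are closed and null -/

noncomputable section
namespace Alternahedra

open scoped InnerProductSpace

variable {d : ℕ}

/-- On every line in direction `w`, the difference of the forms is a quadratic polynomial with
leading coefficient `A ≠ 0`, so it has finitely many roots. -/
theorem ae_inner_apply_ne {V : Type*} [NormedAddCommGroup V] [NormedSpace ℝ V]
    [FiniteDimensional ℝ V] [MeasurableSpace V] [BorelSpace V] (μ : Measure V)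
    [μ.IsAddHaarMeasure] (φ : V →ₗ[ℝ] Euc d) (hφ : Function.Surjective φ) (g k : Orth d)
    (hgk : ∃ v, ⟪g v, v⟫_ℝ ≠ ⟪k v, v⟫_ℝ) :
    ∀ᵐ x ∂μ, ⟪g (φ x), φ x⟫_ℝ ≠ ⟪k (φ x), φ x⟫_ℝ := by
  obtain ⟨v, hv⟩ := hgk
  obtain ⟨w, rfl⟩ := hφ v
  have hφc : Continuous φ := φ.continuous_of_finiteDimensional
  have hmeas : MeasurableSet {x | ⟪g (φ x), φ x⟫_ℝ ≠ ⟪k (φ x), φ x⟫_ℝ} := by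
    refine IsOpen.measurableSet (isOpen_ne_fun ?_ ?_)
    · exact (g.continuous.comp hφc).inner hφc
    · exact (k.continuous.comp hφc).inner hφc
  have := FiniteDimensional.proper_real V
  refine ae_mem_of_ae_add_linearMap_mem (LinearMap.toSpanSingleton ℝ V w) volume μ hmeas ?_
  intro y
  set A := ⟪g (φ w), φ w⟫_ℝ - ⟪k (φ w), φ w⟫_ℝ with hA
  set B := ⟪g (φ w), φ y⟫_ℝ + ⟪g (φ y), φ w⟫_ℝ - ⟪k (φ w), φ y⟫_ℝ - ⟪k (φ y), φ w⟫_ℝ with hB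
  set C := ⟪g (φ y), φ y⟫_ℝ - ⟪k (φ y), φ y⟫_ℝ with hC
  set p : Polynomial ℝ := .C A * .X ^ 2 + .C B * .X + .C C with hp
  have hp0 : p ≠ 0 := by
    intro h
    have h2 : p.coeff 2 = A := by simp [hp]
    rw [h, Polynomial.coeff_zero] at h2
    exact sub_ne_zero.2 hv h2.symm
  have hfin : {t : ℝ | p.IsRoot t}.Finite := Polynomial.finite_setOfPred_isRoot hp0
  filter_upwards [measure_eq_zero_iff_ae_notMem.1 (hfin.measure_zero volume)] with t ht
  intro heq
  apply ht
  change p.eval t = 0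
  rw [LinearMap.toSpanSingleton_apply] at heq
  simp only [map_add, map_smul, inner_add_left, inner_add_right, inner_smul_left,
    inner_smul_right, RCLike.conj_to_real] at heq
  simp only [hp, Polynomial.eval_add, Polynomial.eval_mul, Polynomial.eval_C, Polynomial.eval_pow,
    Polynomial.eval_X, hA, hB, hC]
  linear_combination heq

/-- Equal dimensions leave two cases: either `Φ` is bijective and the bad set is the zero set of a
nonzero quadratic form, or its range is a null subspace and almost no `t` has a solution. -/
theorem ae_forall_inner_apply_ne_of_linearMap_eq {S X : Type*} [AddCommGroup S] [Module ℝ S]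
    [FiniteDimensional ℝ S] [NormedAddCommGroup X] [NormedSpace ℝ X] [FiniteDimensional ℝ X]
    [MeasurableSpace X] [BorelSpace X] (μ : Measure X) [μ.IsAddHaarMeasure]
    (hSX : Module.finrank ℝ S = Module.finrank ℝ X) (Φ : S →ₗ[ℝ] X) (φ : S →ₗ[ℝ] Euc d)
    (hφ : Function.Surjective φ) (g k : Orth d) (hgk : ∃ v, ⟪g v, v⟫_ℝ ≠ ⟪k v, v⟫_ℝ) (x₀ : X) :
    ∀ᵐ t ∂μ, ∀ s, Φ s = t + x₀ → ⟪g (φ s), φ s⟫_ℝ ≠ ⟪k (φ s), φ s⟫_ℝ := by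
  refine (measurePreserving_add_right μ x₀).quasiMeasurePreserving.ae
    (p := fun t => ∀ s, Φ s = t → ⟪g (φ s), φ s⟫_ℝ ≠ ⟪k (φ s), φ s⟫_ℝ) ?_
  by_cases hsurj : Function.Surjective Φ
  · have hinj := (LinearMap.injective_iff_surjective_of_finrank_eq_finrank hSX).2 hsurj
    let e := LinearEquiv.ofBijective Φ ⟨hinj, hsurj⟩
    filter_upwards [ae_inner_apply_ne μ (φ ∘ₗ e.symm.toLinearMap)
      (hφ.comp e.symm.surjective) g k hgk] with t ht s hs
    have : e.symm t = s := by rw [LinearEquiv.symm_apply_eq, ← hs]; rfl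
    simpa [this] using ht
  · have hnull := Measure.addHaar_submodule μ (LinearMap.range Φ)
      (fun h => hsurj (LinearMap.range_eq_top.1 h))
    filter_upwards [measure_eq_zero_iff_ae_notMem.1 hnull] with t ht s hs
    exact absurd ⟨s, hs⟩ ht

open Classical in
/-- The configurations whose `c`-coloured classes admit a point in each convex hull such that these
points form an orbit of a vector `u` on which the quadratic forms of `g` and `k` agree. -/
def nongenericConfigurations (H : Subgroup (Orth d)) {N : ℕ} (c : Fin N → H) (g k : Orth d) :
    Set (Fin N → Euc d) :=
  {z | ∃ l : Fin N → ℝ, (∀ j, 0 ≤ l j) ∧ (∀ h, ∑ j with c j = h, l j = 1) ∧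
    ∃ a u : Euc d, ⟪g u, u⟫_ℝ = ⟪k u, u⟫_ℝ ∧
      ∀ h : H, ∑ j with c j = h, l j • z j = a + (h : Orth d) u}

-- Weights form a compact set, and the allowed orbits form a closed set because `Θ` is a closed
-- embedding. Projecting a closed set along a compact factor keeps it closed.
open Classical in
theorem isClosed_nongenericConfigurations (H : Subgroup (Orth d)) [Finite H]
    (hH : ∀ v : Euc d, (∀ g ∈ H, g v = v) → v = 0) {N : ℕ} (c : Fin N → H) (g k : Orth d) :
    IsClosed (nongenericConfigurations H c g k) := by
  have := Fintype.ofFinite H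
  let Θ : (Euc d × Euc d) →ₗ[ℝ] (H → Euc d) :=
    { toFun := fun x h => x.1 + (h : Orth d) x.2
      map_add' := fun x y => by
        ext1 h
        simp only [Prod.fst_add, Prod.snd_add, map_add, Pi.add_apply]
        abel
      map_smul' := fun t x => by
        ext1 h
        simp }
  have hΘ : Function.Injective Θ := by
    rw [← LinearMap.ker_eq_bot, LinearMap.ker_eq_bot']
    rintro ⟨a, u⟩ h
    have hg : ∀ g : H, a + (g : Orth d) u = 0 := fun g => congrFun h g
    have h1 : a + u = 0 := hg 1
    have hu : u = 0 := hH u fun g hgH => add_left_cancel ((hg ⟨g, hgH⟩).trans h1.symm)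
    subst hu
    rw [add_zero] at h1
    rw [h1]
    rfl
  have hK : IsClosed (Θ '' {x | ⟪g x.2, x.2⟫_ℝ = ⟪k x.2, x.2⟫_ℝ}) := by
    refine (LinearMap.isClosedEmbedding_of_injective (LinearMap.ker_eq_bot.2 hΘ)).isClosedMap _ ?_
    exact isClosed_eq ((g.continuous.comp continuous_snd).inner continuous_snd)
      ((k.continuous.comp continuous_snd).inner continuous_snd)
  let D : Set (Fin N → ℝ) := {l | (∀ j, 0 ≤ l j) ∧ ∀ h, ∑ j with c j = h, l j = 1}
  have hD : IsCompact D := by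
    refine (isCompact_Icc (a := (0 : Fin N → ℝ)) (b := 1)).of_isClosed_subset ?_ ?_
    · have h1 : IsClosed {l : Fin N → ℝ | ∀ j, 0 ≤ l j} := by
        simp only [Set.ofPred_forall]
        exact isClosed_iInter fun j => isClosed_le continuous_const (continuous_apply j)
      have h2 : IsClosed {l : Fin N → ℝ | ∀ h, ∑ j with c j = h, l j = 1} := by
        simp only [Set.ofPred_forall]
        exact isClosed_iInter fun h => isClosed_eq (by fun_prop) continuous_const
      exact h1.inter h2
    · rintro l ⟨hl0, hl1⟩
      refine ⟨hl0, fun j => ?_⟩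
      rw [Pi.one_apply, ← hl1 (c j)]
      exact Finset.single_le_sum (fun i _ => hl0 i) (by simp)
  have := isCompact_iff_compactSpace.1 hD
  let F : D × (Fin N → Euc d) → (H → Euc d) := fun x h => ∑ j with c j = h, x.1.1 j • x.2 j
  have hF : Continuous F := by
    refine continuous_pi fun h => continuous_finsetSum _ fun j _ => ?_
    exact ((continuous_apply j).comp (continuous_subtype_val.comp continuous_fst)).smul
      ((continuous_apply j).comp continuous_snd)
  convert isClosedMap_snd_of_compactSpace _ (hK.preimage hF)
  ext z
  constructor
  · rintro ⟨l, hl0, hl1, a, u, hu, hau⟩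
    exact ⟨⟨⟨l, hl0, hl1⟩, z⟩, ⟨⟨a, u⟩, hu, funext fun h => (hau h).symm⟩, rfl⟩
  · rintro ⟨⟨l, z⟩, ⟨⟨a, u⟩, hu, hau⟩, rfl⟩
    exact ⟨l.1, l.2.1, l.2.2, a, u, hu, fun h => (congrFun hau h).symm⟩

open Classical in
theorem ae_notMem_nongenericConfigurations (H : Subgroup (Orth d)) [Fintype H]
    (hH : ∀ v : Euc d, (∀ g ∈ H, g v = v) → v = 0) {N : ℕ}
    (hN : Fintype.card H * (d + 1) = N + 2 * d) (c : Fin N → H) (g k : Orth d)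
    (hgk : ∃ v, ⟪g v, v⟫_ℝ ≠ ⟪k v, v⟫_ℝ) :
    ∀ᵐ z : Fin N → Euc d, z ∉ nongenericConfigurations H c g k := by
  by_cases hc : Function.Surjective c
  swap
  · refine Filter.Eventually.of_forall fun z => ?_
    rintro ⟨l, -, hl, -⟩
    apply hc
    intro h
    by_contra! hne
    have := hl h
    rw [Finset.sum_eq_zero fun j hj => absurd (Finset.mem_filter.1 hj).2 (hne j)] at this
    exact zero_ne_one this
  -- It suffices to translate each colour class rigidly by its own vector `t h`. Since the weights
  -- of a class sum to 1, this shifts its convex combination by exactly `t h`, and the system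
  -- becomes linear in the unknowns.
  refine ae_mem_of_ae_add_linearMap_mem (LinearMap.funLeft ℝ (Euc d) c) volume volume
    (isClosed_nongenericConfigurations H hH c g k).isOpen_compl.measurableSet ?_
  intro y
  let Λ : (Fin N → ℝ) →ₗ[ℝ] (H → ℝ) :=
    { toFun := fun l h => ∑ j with c j = h, l j
      map_add' := fun l l' => by
        ext1 h
        simp [Finset.sum_add_distrib]
      map_smul' := fun t l => by
        ext1 h
        simp [Finset.mul_sum] }
  have hΛ : Function.Surjective Λ := by
    intro x
    obtain ⟨b, hb⟩ := hc.hasRightInverse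
    refine ⟨fun j => if b (c j) = j then x (c j) else 0, ?_⟩
    ext1 h
    change ∑ j with c j = h, (if b (c j) = j then x (c j) else 0) = x h
    rw [Finset.sum_eq_single_of_mem (b h) (by simp [hb h])]
    · rw [hb h, if_pos rfl]
    · intro j hj hne
      rw [(Finset.mem_filter.1 hj).2, if_neg hne.symm]
  obtain ⟨l₀, hl₀⟩ := hΛ 1
  let Φ : (LinearMap.ker Λ × Euc d × Euc d) →ₗ[ℝ] (H → Euc d) :=
    { toFun := fun s h => s.2.1 + (h : Orth d) s.2.2 - ∑ j with c j = h, s.1.1 j • y j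
      map_add' := fun s s' => by
        ext1 h
        simp only [Prod.fst_add, Prod.snd_add, map_add, Pi.add_apply, Submodule.coe_add, add_smul,
          Finset.sum_add_distrib]
        abel
      map_smul' := fun t s => by
        ext1 h
        simp only [Prod.smul_fst, Prod.smul_snd, map_smul, Pi.smul_apply, Submodule.coe_smul,
          smul_eq_mul, mul_smul, ← Finset.smul_sum, RingHom.id_apply, smul_sub, smul_add] }
  let φ : (LinearMap.ker Λ × Euc d × Euc d) →ₗ[ℝ] Euc d :=
    LinearMap.snd ℝ _ _ ∘ₗ LinearMap.snd ℝ _ _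
  have hφ : Function.Surjective φ := fun v => ⟨(0, 0, v), rfl⟩
  have hrank := Λ.finrank_range_add_finrank_ker
  rw [LinearMap.range_eq_top.2 hΛ, finrank_top, Module.finrank_fintype_fun_eq_card,
    Module.finrank_fintype_fun_eq_card, Fintype.card_fin] at hrank
  -- Both sides are rd: the weights with fixed class sums contribute N - r, and the centre and `u`
  -- contribute 2d.
  have hdim : Module.finrank ℝ (LinearMap.ker Λ × Euc d × Euc d)
      = Module.finrank ℝ (H → Euc d) := by
    rw [Module.finrank_pi_fintype]
    simp only [Module.finrank_prod, finrank_euclideanSpace_fin, Finset.sum_const, Finset.card_univ,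
      smul_eq_mul]
    rw [mul_add] at hN
    omega
  filter_upwards [ae_forall_inner_apply_ne_of_linearMap_eq volume hdim Φ φ hφ g k hgk
    (fun h => ∑ j with c j = h, l₀ j • y j)] with t ht
  rintro ⟨l, -, hl, a, u, hu, hau⟩
  have hker : l - l₀ ∈ LinearMap.ker Λ := by
    rw [LinearMap.mem_ker, map_sub, hl₀, sub_eq_zero]
    ext1 h
    exact hl h
  refine ht (⟨l - l₀, hker⟩, a, u) ?_ hu
  ext1 h
  change a + (h : Orth d) u - ∑ j with c j = h, (l - l₀) j • y j
    = t h + ∑ j with c j = h, l₀ j • y j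
  have h1 : ∑ j with c j = h, l j • (y + LinearMap.funLeft ℝ (Euc d) c t) j
      = ∑ j with c j = h, l j • y j + t h := by
    simp only [Pi.add_apply, smul_add, Finset.sum_add_distrib, LinearMap.funLeft_apply]
    congr 1
    rw [← one_smul ℝ (t h), ← hl h, Finset.sum_smul]
    exact Finset.sum_congr rfl fun j hj => by rw [(Finset.mem_filter.1 hj).2]
  rw [← hau h, h1]
  simp only [Pi.sub_apply, sub_smul, Finset.sum_sub_distrib]
  abel

end Alternahedra
end

/-! ### Assembly of the generic partition -/

noncomputable section
namespace Alternahedra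

open scoped InnerProductSpace

variable {d : ℕ}

theorem ae_apply_ne (hd : 3 ≤ d) {N : ℕ} {i j : Fin N} (hij : i ≠ j) :
    ∀ᵐ z : Fin N → Euc d, z i ≠ z j := by
  let f : (Fin N → Euc d) →ₗ[ℝ] Euc d :=
    LinearMap.proj (R := ℝ) (φ := fun _ => Euc d) i - LinearMap.proj j
  have hf : LinearMap.ker f ≠ ⊤ := by
    intro h
    obtain ⟨x, hx⟩ := exists_ne_zero hd
    have hmem : Pi.single i x ∈ LinearMap.ker f := h ▸ Submodule.mem_top
    have : f (Pi.single i x) = x := by simp [f, hij.symm]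
    rw [LinearMap.mem_ker, this] at hmem
    exact hx hmem
  filter_upwards [measure_eq_zero_iff_ae_notMem.1 (Measure.addHaar_submodule volume _ hf)]
    with z hz heq
  exact hz (LinearMap.mem_ker.2 (sub_eq_zero.2 heq))

open Classical in
theorem canBePartitioned_of_coloring {H : Subgroup (Orth d)} [Fintype H] {r N : ℕ}
    (hr : r = Nat.card H) {a u : Euc d} (hu : IsFreeVector H u)
    (hP : IsFullPolytope r (orbitPolytope H u a)) {z : Fin N → Euc d}
    (hz : Function.Injective z) {c : Fin N → H} {l : Fin N → ℝ} (hl0 : ∀ j, 0 ≤ l j)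
    (hl : ∀ h, ∑ j with c j = h, l j = 1)
    (hau : ∀ h : H, ∑ j with c j = h, l j • z j = a + (h : Orth d) u) :
    CanBePartitioned r (Set.range z) (orbitPolytope H u a) := by
  let e : Fin r ≃ H := (Fintype.equivFinOfCardEq (by rw [hr, Nat.card_eq_fintype_card])).symm
  refine ⟨hP, fun i => z '' {j | c j = e i}, fun i => a + (e i : Orth d) u, ?_, ?_, ?_, ?_, ?_⟩
  · intro i i' hii'
    rw [Set.disjoint_image_iff hz, Set.disjoint_left]
    intro j (hj : c j = e i) (hj' : c j = e i')
    exact hii' (e.injective (hj.symm.trans hj'))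
  · ext x
    simp only [Set.mem_iUnion]
    constructor
    · rintro ⟨i, j, -, rfl⟩
      exact ⟨j, rfl⟩
    · rintro ⟨j, rfl⟩
      exact ⟨e.symm (c j), j, (e.apply_symm_apply (c j)).symm, rfl⟩
  · intro i
    beta_reduce
    rw [← hau (e i)]
    exact (convex_convexHull ℝ _).sum_mem (fun j _ => hl0 j) (hl (e i)) fun j hj =>
      subset_convexHull ℝ _ ⟨j, (Finset.mem_filter.1 hj).2, rfl⟩
  · exact (hu.orbit_injective a).comp e.injective
  · rw [extremePoints_orbitPolytope, setOf_orbit_eq_range]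
    exact e.surjective.range_comp fun h : H => a + (h : Orth d) u

/-- Generic point sets can be partitioned by a Coxeter alternahedron whose isometry group is the
rotation group. -/
theorem holdsForGenericSet_canBePartitioned (hd : 3 ≤ d)
    {G : Subgroup (Orth d)}
    (hG : IsFiniteReflectionGroup G)
    (hirr : (inclusionRep G).IsIrreducible)
    {r : ℕ} (hr : r = Nat.card (rotationSubgroup G)) :
    HoldsForGenericSet ((r - 2) * (d + 1) + 2) d (fun X =>
      ∃ (a : Euc d) (P : Set (Euc d)),
        IsCoxeterAlternahedron G a P ∧
        isoGroup P
          = actionAround (rotationSubgroup G) a ∧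
        CanBePartitioned r X P) := by
  classical
  have := hG.1
  have := finite_rotationSubgroup hG
  have := Fintype.ofFinite (rotationSubgroup G)
  have hfixed : ∀ v : Euc d, (∀ g ∈ rotationSubgroup G, g v = v) → v = 0 := fun v hv =>
    eq_zero_of_fixed hd hG hirr hv
  set N := (r - 2) * (d + 1) + 2 with hN_def
  have hN : Fintype.card (rotationSubgroup G) * (d + 1) = N + 2 * d := by
    have h2 := two_le_card_rotationSubgroup hd hG hirr
    rw [← hr] at h2
    rw [← Nat.card_eq_fintype_card, ← hr]
    obtain ⟨m, rfl⟩ := Nat.exists_eq_add_of_le h2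
    rw [hN_def, Nat.add_sub_cancel_left]
    ring
  -- Only pairs with different forms are excluded; there are finitely many of them and finitely many
  -- colourings.
  let I := {x : (Fin N → rotationSubgroup G) × G × G //
    ∃ v, inner ℝ ((x.2.1 : Orth d) v) v ≠ inner ℝ ((x.2.2 : Orth d) v) v}
  let U : Set (Fin N → Euc d) := {z | (∀ p : {p : Fin N × Fin N // p.1 ≠ p.2}, z p.1.1 ≠ z p.1.2) ∧
    ∀ i : I, z ∉ nongenericConfigurations (rotationSubgroup G) i.1.1 i.1.2.1 i.1.2.2}
  have hUae : ∀ᵐ z : Fin N → Euc d, z ∈ U :=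
    (ae_all_iff.2 fun p => ae_apply_ne hd p.2).and (ae_all_iff.2 fun i =>
      ae_notMem_nongenericConfigurations _ hfixed hN i.1.1 i.1.2.1 i.1.2.2 i.2)
  have hUopen : IsOpen U := by
    have h1 : IsOpen {z : Fin N → Euc d |
        ∀ p : {p : Fin N × Fin N // p.1 ≠ p.2}, z p.1.1 ≠ z p.1.2} := by
      simp only [Set.ofPred_forall]
      exact isOpen_iInter_of_finite fun p =>
        isOpen_ne_fun (continuous_apply _) (continuous_apply _)
    have h2 : IsOpen {z : Fin N → Euc d |
        ∀ i : I, z ∉ nongenericConfigurations (rotationSubgroup G) i.1.1 i.1.2.1 i.1.2.2} := by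
      simp only [Set.ofPred_forall]
      exact isOpen_iInter_of_finite fun i =>
        (isClosed_nongenericConfigurations _ hfixed i.1.1 i.1.2.1 i.1.2.2).isOpen_compl
    exact h1.inter h2
  refine ⟨U, hUopen, Measure.dense_of_ae hUae, hUae, fun z hz => ?_⟩
  have hinj : Function.Injective z := by
    intro i j hij
    by_contra hne
    exact hz.1 ⟨(i, j), hne⟩ hij
  refine ⟨hinj, ?_⟩
  obtain ⟨c, l, hl0, hl, a, u, hau⟩ :=
    exists_coloring_orbit (rotationSubgroup G) hfixed hN.le z
  have hu : IsGenericVector G u := by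
    intro g hg k hk heq
    by_contra! hne
    exact hz.2 ⟨(c, ⟨g, hg⟩, ⟨k, hk⟩), hne⟩ ⟨l, hl0, hl, a, u, heq, hau⟩
  have hfree := hu.isFreeVector hd hG hirr
  refine ⟨a, _, ⟨u, hfree, rfl⟩, isoGroup_orbitPolytope hd hG hirr hu a, ?_⟩
  exact canBePartitioned_of_coloring hr hfree
    (hr ▸ isFullPolytope_orbitPolytope hd hG hirr hfree a) hinj hl0 hl hau

end Alternahedra
end

theorem proposition4p2 (d : ℕ) (hd : 3 ≤ d)
    (G : Subgroup (Alternahedra.Orth d))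
    (hG : Alternahedra.IsFiniteReflectionGroup G)
    (hirr : (Alternahedra.inclusionRep G).IsIrreducible)
    (r : ℕ) (hr : r = Nat.card (Alternahedra.rotationSubgroup G)) :
    Alternahedra.HoldsForGenericSet ((r - 2) * (d + 1) + 2) d (fun X =>
      ∃ (a : Alternahedra.Euc d) (P : Set (Alternahedra.Euc d)),
        Alternahedra.IsCoxeterAlternahedron G a P ∧
        Alternahedra.isoGroup P
          = Alternahedra.actionAround (Alternahedra.rotationSubgroup G) a ∧
        Alternahedra.CanBePartitioned r X P) :=
  Alternahedra.holdsForGenericSet_canBePartitioned hd hG hirr hr
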